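/- Let $d\in\{2,3\}$ and let $\mathcal T$ be a conforming mesh of finitely many nondegenerate $d$-simplices $\Omega_e\subset\mathbb R^d$ (two elements meet exactly in the simplex spanned by their common vertices, possibly empty). Let $\Omega$ be the interior of the union of the elements and $\Gamma=\partial\Omega$; this includes every bounded Lipschitz domain that is exactly triangulated by $\mathcal T$. Write $\langle\cdot,\cdot\rangle$, $\|\cdot\|$ for the $L^2(\Omega)$ product and norm (Frobenius product for tensors), $\|\cdot\|_\infty$ for the $L^\infty(\Omega)$ norm, $h_e=\operatorname{diam}\Omega_e$, $h=\max_e h_e$, and let $Q\ge 1$ be such that $1\le h/h_e\le Q$ for all $e$ (quasi-uniformity). Let $k,l\ge 1$. Let $X_h$ be the space of vector fields that are continuous on $\overline\Omega$, have components of degree at most $k$ on each element, and vanish on $\Gamma$, and let $Y_h$ be the space of scalar functions that are continuous on $\overline\Omega$ and polynomial of degree at most $l$ on each element. No compatibility (inf-sup) condition between $X_h$ and $Y_h$ is assumed. Call $C_{\rm tr}$ a trace constant of $\mathcal T$ if for every element $\Omega_e$ and every polynomial $v$ of degree at most $\max(k,l)$ $$\sqrt{h_e}\,\|v\|_{L^2(F)}\le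 C_{\rm tr}\|v\|_{L^2(\Omega_e)}$$ for every face $F$ of $\Omega_e$ and also for $F=\Gamma\cap\partial\Omega_e$ (the union of the faces of $\Omega_e$ on $\Gamma$). For a sequence $(a_n)$ put $a_{n}^\star=2a_{n-1}-a_{n-2}$ and $\delta^2a_n=a_n-2a_{n-1}+a_{n-2}$. Let $\nu,\gamma,\alpha,T>0$, let $N\ge1$ be an integer, and let $\tau=T/N$. Let $u_n\in X_h$, $p_n\in Y_h$, $\psi_n\in\mathbb R$ ($0\le n\le N$), with arbitrary starting values for $n=0,1$, satisfy the BDF2 consistent-splitting SAV scheme with zero body force and homogeneous Dirichlet data, that is, for $1\le n\le N-1$, all $v\in X_h$ and all $q\in Y_h$, $$\Big\langle\tfrac{3u_{n+1}-4u_n+u_{n-1}}{2\tau},v\Big\rangle+\Big\langle u_{n+1}^\star\cdot\nabla u_{n+1}+\tfrac{\nabla\cdot u_{n+1}^\star}{2}u_{n+1},v\Big\rangle+\nu\langle\nabla u_{n+1},\nabla v\rangle+\gamma\nu\langle\nabla\cdot u_{n+1},\nabla\cdot v\rangle=\psi_{n+1}\langle p_{n+1}^\star,\nabla\cdot v\rangle,$$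 $$\frac{3\psi_{n+1}-4\psi_n+\psi_{n-1}}{2\tau}=-\alpha\langle p_{n+1}^\star,\nabla\cdot u_{n+1}\rangle,$$ $$\psi_{n+1}\langle\nabla p_{n+1},\nabla q\rangle=-\Big\langle u_{n+1}\cdot\nabla u_{n+1}+\tfrac{\nabla\cdot u_{n+1}}{2}u_{n+1},\nabla q\Big\rangle+\langle\nu\nabla\times u_{n+1},\mathbf n\times\nabla q\rangle_{\Gamma},$$ where $\mathbf n$ is the outward unit normal and the boundary term uses the one-sided elementwise traces of $\nabla u_{n+1}$ and $\nabla q$. Define $$\Phi_n=\Big(\frac{\psi_n}{\sqrt\alpha}\Big)^2+\Big(\frac{\psi_{n+1}^\star}{\sqrt\alpha}\Big)^2+\|u_n\|^2+\|u_{n+1}^\star\|^2,\qquad \beta_n=\Big(\frac1\nu\|u_n\|_\infty^2+\frac{C\nu}{h^2}\Big)^{-1},\qquad C=(C_{\rm tr}^2Q)^2 .$$ **Theorem.** (i) For every $\sigma$ there is a $C_{\rm tr}>0$, depending only on $\sigma$, $d$ and $\max(k,l)$, that is a trace constant of every mesh whose elements all have a ratio of diameter to inradius of at most $\sigma$ (shape-regularity).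 (ii) For any mesh, any $Q$ and any trace constant $C_{\rm tr}$ of the mesh as above, every solution of the scheme satisfies, for any time-step size $\tau=T/N$, $$\Phi_N+\sum_{n=2}^N\Big[\Big(\frac{\delta^2\psi_n}{\sqrt\alpha}\Big)^2+\|\delta^2u_n\|^2+4\tau\nu\|\nabla u_n\|^2+4\gamma\tau\nu\|\nabla\cdot u_n\|^2\Big]=\Phi_1,$$ $$\Phi_N+\sum_{n=2}^N\Big[\frac87\tau\beta_n\psi_n^2\|\nabla p_n\|^2+\Big(\frac{\delta^2\psi_n}{\sqrt\alpha}\Big)^2+\|\delta^2u_n\|^2+4\tau\nu\gamma\|\nabla\cdot u_n\|^2\Big]\le\Phi_1 .$$ -/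

import Mathlib

open MeasureTheory

namespace SplittingSAV

/-- The ambient Euclidean space `ℝ^d`. -/
abbrev Sp (d : ℕ) : Type := EuclideanSpace ℝ (Fin d)

/-! ### Meshes -/

/-- A conforming simplicial mesh in `ℝ^d`: finitely many nondegenerate `d`-simplices, pairwise
distinct, any two of which meet exactly in the simplex spanned by their common vertices
(possibly empty). -/
structure Mesh (d : ℕ) where
  numElems : ℕ
  numElems_pos : 0 < numElems
  elem : Fin numElems → Affine.Simplex ℝ (Sp d) d
  distinct : ∀ e e', e ≠ e' → Set.range (elem e).points ≠ Set.range (elem e').points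
  conforming : ∀ e e',
    convexHull ℝ (Set.range (elem e).points) ∩ convexHull ℝ (Set.range (elem e').points) =
      convexHull ℝ (Set.range (elem e).points ∩ Set.range (elem e').points)

namespace Mesh

variable {d : ℕ} (M : Mesh d)

/-- The closed element `Ω_e`. -/
def cell (e : Fin M.numElems) : Set (Sp d) :=
  convexHull ℝ (Set.range (M.elem e).points)

/-- The face of the element `e` opposite to its `i`-th vertex. -/
def face (e : Fin M.numElems) (i : Fin (d + 1)) : Set (Sp d) :=
  convexHull ℝ ((M.elem e).points '' {i}ᶜ)

/-- The meshed domain `Ω`. Every bounded Lipschitz domain whose closure is the union of the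
elements equals the interior of that union. -/
def domain : Set (Sp d) := interior (⋃ e, M.cell e)

/-- The boundary `Γ = ∂Ω`. -/
def bdry : Set (Sp d) := frontier M.domain

/-- The size `h_e` of an element: its diameter. -/
noncomputable def elemSize (e : Fin M.numElems) : ℝ := Metric.diam (M.cell e)

/-- The mesh size `h`: the maximum of the element sizes. -/
noncomputable def size : ℝ := ⨆ e, M.elemSize e

/-- Outward unit normal of the element `e` on the face opposite to vertex `i`: the direction from
that vertex to the foot of its altitude. -/
noncomputable def normal [NeZero d] (e : Fin M.numElems) (i : Fin (d + 1)) : Sp d :=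
  ((M.elem e).height i)⁻¹ • ((M.elem e).altitudeFoot i - (M.elem e).points i)

/-- Shape regularity: the ratio of the diameter to the inradius of each element is at most `σ`. -/
def ShapeRegular [NeZero d] (σ : ℝ) : Prop :=
  ∀ e, M.elemSize e ≤ σ * (M.elem e).inradius

/-- Global quasi-uniformity `1 ≤ h / h_e ≤ Q` (the lower bound holds by definition of `h`). -/
def QuasiUniform (Q : ℝ) : Prop :=
  1 ≤ Q ∧ ∀ e, M.size / M.elemSize e ≤ Q

/-- `∫_{Γ ∩ ∂Ω_e} f dσ`: the sum over the faces of `e` lying on `Γ` of the surface integrals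
(the integrand may depend on the face, through its normal). -/
noncomputable def bdryIntegral (e : Fin M.numElems) (f : Fin (d + 1) → Sp d → ℝ) : ℝ :=
  open Classical in
  ∑ i : Fin (d + 1), if M.face e i ⊆ M.bdry then ∫ x in M.face e i, f i x ∂μHE[d - 1] else 0

/-- `C_tr` is a discrete trace constant for polynomials `v` of degree at most `r`:
`√h_e ‖v‖_{L²(F)} ≤ C_tr ‖v‖_{L²(Ω_e)}` for every face `F` of every element `Ω_e`, and also for
`F = Γ ∩ ∂Ω_e` (a second condition only if some element has several faces on `Γ`). -/
def IsTraceConstant (r : ℕ) (Ctr : ℝ) : Prop :=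
  ∀ (e : Fin M.numElems) (P : MvPolynomial (Fin d) ℝ), P.totalDegree ≤ r →
    (∀ i, √(M.elemSize e) * √(∫ x in M.face e i, (P.eval fun j => x j) ^ 2 ∂μHE[d - 1]) ≤
      Ctr * √(∫ x in M.cell e, (P.eval fun j => x j) ^ 2)) ∧
    √(M.elemSize e) * √(M.bdryIntegral e fun _ x => (P.eval fun j => x j) ^ 2) ≤
      Ctr * √(∫ x in M.cell e, (P.eval fun j => x j) ^ 2)

/-! ### Lagrangian finite element spaces -/

/-- The scalar `C⁰` Lagrangian space of degree `k`: continuous functions on the closure of `Ω`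
which are polynomials of degree at most `k` on each element (values off the closure of `Ω` are
immaterial). -/
def lagrange (k : ℕ) : Set (Sp d → ℝ) :=
  {v | ContinuousOn v (closure M.domain) ∧
    ∀ e, ∃ P : MvPolynomial (Fin d) ℝ, P.totalDegree ≤ k ∧
      ∀ x ∈ M.cell e, v x = P.eval fun j => x j}

/-- Vector-valued `C⁰` Lagrangian functions of degree `k` that vanish on `Γ`. -/
def velocitySpace (k : ℕ) : Set (Sp d → Sp d) :=
  {v | (∀ i, (fun x => v x i) ∈ M.lagrange k) ∧ ∀ x ∈ M.bdry, v x = 0}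

end Mesh

/-! ### Differential operators

Finite element functions are smooth in the interior of each element, so on `Ω` the almost
everywhere defined classical derivative is their weak derivative. -/

section Operators

variable {d : ℕ}

/-- The `i`-th standard basis vector. -/
noncomputable def basisVec (i : Fin d) : Sp d := EuclideanSpace.single i 1

/-- `∇u` as the `d × d` tensor of partial derivatives `∂_j u_i` (with the Frobenius norm). -/
noncomputable def gradTensor (u : Sp d → Sp d) (x : Sp d) : EuclideanSpace ℝ (Fin d × Fin d) :=
  WithLp.toLp 2 fun ij => (fderiv ℝ u x (basisVec ij.2)) ij.1

/-- The divergence `∇ · u`. -/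
noncomputable def div (u : Sp d → Sp d) (x : Sp d) : ℝ :=
  ∑ i, (fderiv ℝ u x (basisVec i)) i

/-- The convective derivative `(w · ∇) u`. -/
noncomputable def conv (w u : Sp d → Sp d) (x : Sp d) : Sp d := fderiv ℝ u x (w x)

/-- Index set for the components of the curl and of the cross product: pairs `i < j`.
It has one element if `d = 2` and three elements if `d = 3`. -/
abbrev CrossIdx (d : ℕ) : Type := {ij : Fin d × Fin d // ij.1 < ij.2}

/-- The curl of a vector field with derivative `A`: components `∂_i u_j - ∂_j u_i`, `i < j`. -/
noncomputable def curlOf (A : Sp d →L[ℝ] Sp d) (ij : CrossIdx d) : ℝ :=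
  (A (basisVec ij.1.1)) ij.1.2 - (A (basisVec ij.1.2)) ij.1.1

/-- The cross product `a × b`: components `a_i b_j - a_j b_i`, `i < j`. -/
def cross (a b : Sp d) (ij : CrossIdx d) : ℝ := a ij.1.1 * b ij.1.2 - a ij.1.2 * b ij.1.1

/-- The pairing of `curl u` with `a × b`. For `d = 2, 3` it is the usual one, see the next two
lemmas. -/
noncomputable def curlDotCross (A : Sp d →L[ℝ] Sp d) (a b : Sp d) : ℝ :=
  ∑ ij : CrossIdx d, curlOf A ij * cross a b ij

theorem curlDotCross_two (A : Sp 2 →L[ℝ] Sp 2) (a b : Sp 2) :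
    curlDotCross A a b =
      ((A (basisVec 0)) 1 - (A (basisVec 1)) 0) * (a 0 * b 1 - a 1 * b 0) := by
  have h : (Finset.univ : Finset (CrossIdx 2)) = {⟨(0, 1), by decide⟩} := by decide
  simp [curlDotCross, curlOf, cross, h]

theorem curlDotCross_three (A : Sp 3 →L[ℝ] Sp 3) (a b : Sp 3) :
    curlDotCross A a b =
      ![(A (basisVec 1)) 2 - (A (basisVec 2)) 1,
        (A (basisVec 2)) 0 - (A (basisVec 0)) 2,
        (A (basisVec 0)) 1 - (A (basisVec 1)) 0] ⬝ᵥ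
      crossProduct ![a 0, a 1, a 2] ![b 0, b 1, b 2] := by
  have h : (Finset.univ : Finset (CrossIdx 3)) =
      {⟨(0, 1), by decide⟩, ⟨(0, 2), by decide⟩, ⟨(1, 2), by decide⟩} := by decide
  simp [curlDotCross, curlOf, cross, h, cross_apply, dotProduct, Fin.sum_univ_three]
  ring

end Operators

/-! ### Products and norms -/

section Norms

variable {d : ℕ} {F : Type*} [NormedAddCommGroup F]

/-- The `L²(Ω)` product. -/
noncomputable def l2Inner [InnerProductSpace ℝ F] (Ω : Set (Sp d)) (f g : Sp d → F) : ℝ :=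
  ∫ x in Ω, inner ℝ (f x) (g x)

/-- The `L²(Ω)` norm. -/
noncomputable def l2Norm (Ω : Set (Sp d)) (f : Sp d → F) : ℝ := √(∫ x in Ω, ‖f x‖ ^ 2)

/-- The `L^∞(Ω)` norm. -/
noncomputable def supNorm (Ω : Set (Sp d)) (f : Sp d → F) : ℝ :=
  (eLpNorm f ⊤ (volume.restrict Ω)).toReal

/-- `⟨∇ × u, n × ∇q⟩_Γ`, with the elementwise one-sided traces of `∇u` and `∇q` on `Γ`. -/
noncomputable def Mesh.curlBdry [NeZero d] (M : Mesh d) (u : Sp d → Sp d) (q : Sp d → ℝ) : ℝ :=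
  ∑ e, M.bdryIntegral e fun i x =>
    curlDotCross (fderivWithin ℝ u (M.cell e) x) (M.normal e i) (gradientWithin q (M.cell e) x)

end Norms

/-! ### The time-stepping scheme -/

section Scheme

/-- The extrapolation `a_n^⋆ = 2 a_{n-1} - a_{n-2}` (used for `n ≥ 2`). -/
def extrap {V : Type*} [AddCommGroup V] [Module ℝ V] (a : ℕ → V) (n : ℕ) : V :=
  (2 : ℝ) • a (n - 1) - a (n - 2)

/-- The second difference `δ²a_n = a_n - 2 a_{n-1} + a_{n-2}` (used for `n ≥ 2`). -/
def secondDiff {V : Type*} [AddCommGroup V] [Module ℝ V] (a : ℕ → V) (n : ℕ) : V :=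
  a n - (2 : ℝ) • a (n - 1) + a (n - 2)

/-- The BDF2 quotient `(3 a_n - 4 a_{n-1} + a_{n-2}) / (2τ)` (used for `n ≥ 2`). -/
noncomputable def bdf2 {V : Type*} [AddCommGroup V] [Module ℝ V] (τ : ℝ) (a : ℕ → V) (n : ℕ) : V :=
  (2 * τ)⁻¹ • ((3 : ℝ) • a n - (4 : ℝ) • a (n - 1) + a (n - 2))

/-- `(u_n, p_n, ψ_n)`, `0 ≤ n ≤ N`, satisfies the BDF2 consistent-splitting SAV scheme with `f = 0`
and homogeneous Dirichlet data, velocity degree `k` and pressure degree `l`. The starting values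
`n = 0, 1` are arbitrary. -/
structure IsSolution {d : ℕ} [NeZero d] (M : Mesh d) (k l : ℕ) (ν γ α τ : ℝ) (N : ℕ)
    (u : ℕ → Sp d → Sp d) (p : ℕ → Sp d → ℝ) (ψ : ℕ → ℝ) : Prop where
  velocity_mem : ∀ n ≤ N, u n ∈ M.velocitySpace k
  pressure_mem : ∀ n ≤ N, p n ∈ M.lagrange l
  momentum : ∀ n, 2 ≤ n → n ≤ N → ∀ v ∈ M.velocitySpace k,
    l2Inner M.domain (bdf2 τ u n) v +
      l2Inner M.domain
        (fun x => conv (extrap u n) (u n) x + (div (extrap u n) x / 2) • u n x) v +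
      ν * l2Inner M.domain (gradTensor (u n)) (gradTensor v) +
      γ * ν * l2Inner M.domain (div (u n)) (div v) =
    ψ n * l2Inner M.domain (extrap p n) (div v)
  sav : ∀ n, 2 ≤ n → n ≤ N →
    bdf2 τ ψ n = -α * l2Inner M.domain (extrap p n) (div (u n))
  ppe : ∀ n, 2 ≤ n → n ≤ N → ∀ q ∈ M.lagrange l,
    ψ n * l2Inner M.domain (gradient (p n)) (gradient q) =
      l2Inner M.domain (fun x => -conv (u n) (u n) x - (div (u n) x / 2) • u n x) (gradient q) +
      ν * M.curlBdry (u n) q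

/-- The energy `Φ_n`. -/
noncomputable def energy {d : ℕ} (M : Mesh d) (α : ℝ) (u : ℕ → Sp d → Sp d) (ψ : ℕ → ℝ) (n : ℕ) :
    ℝ :=
  (ψ n / √α) ^ 2 + (extrap ψ (n + 1) / √α) ^ 2 +
    l2Norm M.domain (u n) ^ 2 + l2Norm M.domain (extrap u (n + 1)) ^ 2

/-- The weight `β_n = (‖u_n‖_∞² / ν + C ν / h²)⁻¹`. -/
noncomputable def beta {d : ℕ} (M : Mesh d) (ν C : ℝ) (u : ℕ → Sp d → Sp d) (n : ℕ) : ℝ :=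
  (1 / ν * supNorm M.domain (u n) ^ 2 + C * ν / M.size ^ 2)⁻¹

end Scheme

end SplittingSAV

open SplittingSAV

namespace SplittingSAV

open Filter Topology
open scoped NNReal ENNReal

/-! ### Polynomial functions -/

/-! The identity comes from testing the momentum equation with `u n` and multiplying the scalar
equation by `ψ n`: the two pressure terms cancel exactly, whatever the pair of spaces, so no inf-sup
condition enters. The convective term vanishes by skew-symmetry (`Mesh.l2Inner_conv_self`), and an
algebraic identity for BDF2 (`two_inner_bdf2_eq`) turns both difference quotients into telescoping
squares plus second differences.

The inequality follows by trading the viscous dissipation of each step for a pressure term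
(`IsSolution.pressure_bound`). Testing the pressure equation with `p n` bounds |ψ| ‖∇p‖² by a
convective and a boundary contribution. The convective one is at most (3/2) ‖u‖_∞ ‖∇u‖ ‖∇p‖, because
‖∇·u‖ ≤ ‖∇u‖ for zero boundary values (`Mesh.l2Norm_div_le_l2Norm_gradTensor`). For the boundary
one, `u` vanishes on Γ, so its gradient there is rank one and the curl is no larger than the
gradient in Frobenius norm; the trace inequality on both factors then gives C_tr² Q / h
(`Mesh.abs_curlBdry_le`). The numerical margin is (8/7)(13/4) < 4.

Both integration-by-parts facts are obtained without interelement terms: a velocity extended by zero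
is globally Lipschitz, and Lipschitz functions of compact support can be integrated by parts on the
whole space.

Trace constants exist (`Mesh.exists_isTraceConstant`) because on a reference simplex the supremum of
a polynomial of bounded degree is controlled by its L² norm. Affine maps carry this to every
simplex, and shape regularity compares face measure with volume. -/

theorem totalDegree_pderiv_le {σ : Type*} (i : σ) (P : MvPolynomial σ ℝ) :
    (MvPolynomial.pderiv i P).totalDegree ≤ P.totalDegree := by
  classical
  nth_rw 1 [P.as_sum]
  rw [map_sum]
  refine MvPolynomial.totalDegree_finsetSum_le fun s hs => ?_
  rw [MvPolynomial.pderiv_monomial]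
  refine (MvPolynomial.totalDegree_monomial_le _ _).trans
    (le_trans ?_ (MvPolynomial.le_totalDegree hs))
  change (s - Finsupp.single i 1).degree ≤ s.degree
  exact Finsupp.degree_mono tsub_le_self

theorem totalDegree_aeval_le {σ τ : Type*} (L : σ → MvPolynomial τ ℝ)
    (hL : ∀ i, (L i).totalDegree ≤ 1) (P : MvPolynomial σ ℝ) :
    (MvPolynomial.aeval L P).totalDegree ≤ P.totalDegree := by
  classical
  nth_rw 1 [P.as_sum]
  rw [map_sum]
  refine MvPolynomial.totalDegree_finsetSum_le fun s hs => ?_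
  rw [MvPolynomial.aeval_monomial]
  refine le_trans (MvPolynomial.totalDegree_mul _ _) ?_
  rw [MvPolynomial.algebraMap_eq, MvPolynomial.totalDegree_C, zero_add]
  refine le_trans (MvPolynomial.totalDegree_finsetProd _ _) ?_
  refine le_trans (Finset.sum_le_sum fun i _ => ?_) (MvPolynomial.le_totalDegree hs)
  refine (MvPolynomial.totalDegree_pow _ _).trans ?_
  simpa using Nat.mul_le_mul_left (s i) (hL i)

/-- The function on `ℝ^d` defined by a polynomial. -/
noncomputable def polyFun {d : ℕ} (P : MvPolynomial (Fin d) ℝ) (x : Sp d) : ℝ :=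
  P.eval fun j => x j

theorem hasFDerivAt_polyFun {d : ℕ} (P : MvPolynomial (Fin d) ℝ) (x : Sp d) :
    HasFDerivAt (polyFun P)
      (∑ j, polyFun (MvPolynomial.pderiv j P) x • (EuclideanSpace.proj j : Sp d →L[ℝ] ℝ)) x := by
  induction P using MvPolynomial.induction_on with
  | C a =>
    have : polyFun (MvPolynomial.C a : MvPolynomial (Fin d) ℝ) = fun _ => a := by
      ext; simp [polyFun]
    rw [this]
    simpa [polyFun] using hasFDerivAt_const a x
  | add P Q hP hQ =>
    have : polyFun (P + Q) = polyFun P + polyFun Q := by ext; simp [polyFun]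
    rw [this]
    refine (hP.add hQ).congr_fderiv ?_
    simp [polyFun, add_smul, Finset.sum_add_distrib]
  | mul_X P i hP =>
    have : polyFun (P * MvPolynomial.X i) =
        fun y => polyFun P y * (EuclideanSpace.proj i : Sp d →L[ℝ] ℝ) y := by
      ext; simp [polyFun]
    rw [this]
    refine (hP.mul (EuclideanSpace.proj i : Sp d →L[ℝ] ℝ).hasFDerivAt).congr_fderiv ?_
    ext v
    simp only [polyFun, MvPolynomial.pderiv_mul, MvPolynomial.pderiv_X, map_add, map_mul,
      MvPolynomial.eval_X, _root_.sum_apply, _root_.add_apply, _root_.smul_apply, smul_eq_mul,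
      PiLp.proj_apply, add_mul, Finset.sum_add_distrib]
    rw [add_comm]
    congr 1
    · rw [Finset.mul_sum]
      exact Finset.sum_congr rfl fun j _ => by ring
    · rw [Finset.sum_eq_single i]
      · simp
      · intro b _ hb
        simp [hb.symm]
      · simp

theorem contDiff_polyFun {d : ℕ} (P : MvPolynomial (Fin d) ℝ) : ContDiff ℝ 1 (polyFun P) := by
  induction P using MvPolynomial.induction_on with
  | C a =>
    have : polyFun (MvPolynomial.C a : MvPolynomial (Fin d) ℝ) = fun _ => a := by
      ext; simp [polyFun]
    rw [this]
    exact contDiff_const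
  | add P Q hP hQ =>
    have : polyFun (P + Q) = polyFun P + polyFun Q := by ext; simp [polyFun]
    rw [this]
    exact hP.add hQ
  | mul_X P i hP =>
    have : polyFun (P * MvPolynomial.X i) =
        fun y => polyFun P y * (EuclideanSpace.proj i : Sp d →L[ℝ] ℝ) y := by
      ext; simp [polyFun]
    rw [this]
    exact hP.mul (EuclideanSpace.proj i : Sp d →L[ℝ] ℝ).contDiff

theorem continuous_polyFun {d : ℕ} (P : MvPolynomial (Fin d) ℝ) : Continuous (polyFun P) :=
  (contDiff_polyFun P).continuous

/-! ### Lipschitz functions -/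

/-- A mean value inequality along segments, where only right difference quotients are inspected.
Hence the local hypothesis need only compare `y` with the centre `x`, not two arbitrary points near
`x`. -/
theorem lipschitzWith_of_eventually_norm_sub_le {E : Type*} [NormedAddCommGroup E]
    [NormedSpace ℝ E] {f : E → ℝ} (hf : Continuous f) (K : ℝ≥0)
    (h : ∀ x, ∀ᶠ y in 𝓝 x, |f y - f x| ≤ K * ‖y - x‖) : LipschitzWith K f := by
  refine LipschitzWith.of_le_add_mul K fun y x => ?_
  set c : ℝ → E := fun t => x + t • (y - x) with hc
  have hcc : Continuous c := by fun_prop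
  have key := image_le_of_liminf_slope_right_le_deriv_boundary (f := fun t => f (c t)) (a := 0)
    (b := 1) (B := fun t => f x + t * (K * ‖y - x‖)) (B' := fun _ => K * ‖y - x‖)
    (hf.comp hcc).continuousOn (by simp [hc]) (by fun_prop)
    (fun t _ => by
      simpa using (((hasDerivAt_id t).mul_const (K * ‖y - x‖)).const_add (f x)).hasDerivWithinAt)
    (fun t _ r hr => by
      refine Eventually.frequently ?_
      have h1 : ∀ᶠ z in 𝓝[>] t, |f (c z) - f (c t)| ≤ K * ‖c z - c t‖ :=
        (hcc.tendsto t).eventually (h (c t)) |>.filter_mono nhdsWithin_le_nhds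
      filter_upwards [h1, self_mem_nhdsWithin] with z hz hzt
      have hzt' : 0 < z - t := sub_pos.2 hzt
      have : c z - c t = (z - t) • (y - x) := by simp only [hc]; module
      rw [this, norm_smul, Real.norm_eq_abs, abs_of_pos hzt'] at hz
      refine lt_of_le_of_lt ?_ hr
      rw [slope_def_field, div_le_iff₀ hzt']
      nlinarith [le_abs_self (f (c z) - f (c t))])
  have := key (x := 1) (by simp)
  simp only [hc, one_smul, add_sub_cancel, one_mul] at this
  rwa [dist_eq_norm]

section Lipschitz

variable {E : Type*} [NormedAddCommGroup E] [NormedSpace ℝ E] [MeasurableSpace E] [BorelSpace E]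
  [FiniteDimensional ℝ E] {μ : Measure E} [μ.IsAddHaarMeasure] {C D : ℝ≥0} {f g : E → ℝ}

/-- Integration by parts against the constant function 1. -/
theorem integral_lineDeriv_eq_zero (hf : LipschitzWith C f) (h'f : HasCompactSupport f) (v : E) :
    ∫ x, lineDeriv ℝ f x v ∂μ = 0 := by
  have := LipschitzWith.integral_lineDeriv_mul_eq (μ := μ) (LipschitzWith.const (1 : ℝ)) hf h'f (-v)
  have h0 : ∀ x : E, lineDeriv ℝ (fun _ : E => (1 : ℝ)) x (-v) = 0 := fun x => by
    simp [lineDeriv]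
  simpa [h0] using this.symm

theorem integrable_lineDeriv_mul (hf : LipschitzWith C f) (hg : Integrable g μ) (v : E) :
    Integrable (fun x => lineDeriv ℝ f x v * g x) μ := by
  refine hg.bdd_mul (hf.memLp_lineDeriv (μ := μ) v).aestronglyMeasurable (c := C * ‖v‖) ?_
  exact .of_forall fun _ => norm_lineDeriv_le_of_lipschitz ℝ hf

theorem lineDeriv_eq_zero_of_notMem_tsupport {x : E} (hx : x ∉ tsupport f) (v : E) :
    lineDeriv ℝ f x v = 0 := by
  have h : f =ᶠ[𝓝 x] fun _ => 0 := notMem_tsupport_iff_eventuallyEq.1 hx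
  rw [h.lineDeriv_eq]
  simp [lineDeriv]

theorem integrable_lineDeriv (hf : LipschitzWith C f) (h'f : HasCompactSupport f) (v : E) :
    Integrable (fun x => lineDeriv ℝ f x v) μ := by
  have h1 : IntegrableOn (fun x => lineDeriv ℝ f x v) (tsupport f) μ :=
    (hf.locallyIntegrable_lineDeriv (μ := μ) v).integrableOn_isCompact h'f
  exact (integrableOn_iff_integrable_of_support_subset fun x hx => by
    by_contra h
    exact hx (lineDeriv_eq_zero_of_notMem_tsupport h v)).1 h1

/-- Mixed directional derivatives can be exchanged under the integral sign. -/
theorem integral_lineDeriv_mul_lineDeriv_comm (hf : LipschitzWith C f) (h'f : HasCompactSupport f)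
    (hg : LipschitzWith D g) (h'g : HasCompactSupport g) (v w : E) :
    ∫ x, lineDeriv ℝ f x v * lineDeriv ℝ g x w ∂μ =
      ∫ x, lineDeriv ℝ f x w * lineDeriv ℝ g x v ∂μ := by
  -- Second derivatives need not exist, so one derivative is kept as a difference quotient. The
  -- `w`-derivative is moved across by parts and the shift by translation; both integrals are then
  -- limits of the same expression.
  have hA := LipschitzWith.integral_inv_smul_sub_mul_tendsto_integral_lineDeriv_mul (μ := μ) hf
    (integrable_lineDeriv hg h'g w) v
  have hB := LipschitzWith.integral_inv_smul_sub_mul_tendsto_integral_lineDeriv_mul (μ := μ) hg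
    (integrable_lineDeriv hf h'f w) (-v)
  have hC : ∫ x, lineDeriv ℝ f x w * lineDeriv ℝ g x v ∂μ =
      -∫ x, lineDeriv ℝ g x (-v) * lineDeriv ℝ f x w ∂μ := by
    rw [← integral_neg]
    refine integral_congr_ae (.of_forall fun x => ?_)
    simp only [lineDeriv_neg]; ring
  rw [hC]
  refine tendsto_nhds_unique hA ((hB.neg).congr fun t => ?_)
  have hLf : Integrable f μ := hf.continuous.integrable_of_hasCompactSupport h'f
  have hft : LipschitzWith C fun x => f (x + t • v) := by
    refine LipschitzWith.of_dist_le_mul fun x y => ?_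
    simpa using hf.dist_le_mul (x + t • v) (y + t • v)
  have hgt : LipschitzWith D fun x => g (x + t • -v) := by
    refine LipschitzWith.of_dist_le_mul fun x y => ?_
    simpa using hg.dist_le_mul (x + t • -v) (y + t • -v)
  have hcg : HasCompactSupport fun x => g (x + t • -v) :=
    h'g.comp_homeomorph (Homeomorph.addRight (t • -v))
  have e1 : ∫ x, f (x + t • v) * lineDeriv ℝ g x w ∂μ =
      -∫ x, lineDeriv ℝ f x w * g (x + t • -v) ∂μ := by
    have h1 : ∫ x, f (x + t • v) * lineDeriv ℝ g x w ∂μ =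
        ∫ x, f x * lineDeriv ℝ g (x + t • -v) w ∂μ := by
      rw [← integral_add_right_eq_self _ (t • -v)]
      simp [add_assoc]
    have h2 : ∀ x, lineDeriv ℝ g (x + t • -v) w = lineDeriv ℝ (fun x => g (x + t • -v)) x w := by
      intro x
      simp only [lineDeriv]
      congr 1; ext s; congr 1; abel
    rw [h1, LipschitzWith.integral_lineDeriv_mul_eq hf hgt hcg, ← integral_neg]
    refine integral_congr_ae (.of_forall fun x => ?_)
    simp only [h2, lineDeriv_neg]; ring
  have e2 : ∫ x, f x * lineDeriv ℝ g x w ∂μ = -∫ x, lineDeriv ℝ f x w * g x ∂μ := by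
    rw [LipschitzWith.integral_lineDeriv_mul_eq hf hg h'g, ← integral_neg]
    refine integral_congr_ae (.of_forall fun x => ?_)
    simp only [lineDeriv_neg]; ring
  have i1 : Integrable (fun x => f (x + t • v) * lineDeriv ℝ g x w) μ := by
    simpa [mul_comm] using integrable_lineDeriv_mul hg
      (hft.continuous.integrable_of_hasCompactSupport
        (h'f.comp_homeomorph (Homeomorph.addRight (t • v))) (μ := μ)) w
  have i2 : Integrable (fun x => f x * lineDeriv ℝ g x w) μ := by
    simpa [mul_comm] using integrable_lineDeriv_mul hg hLf w
  have i3 : Integrable (fun x => lineDeriv ℝ f x w * g (x + t • -v)) μ :=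
    integrable_lineDeriv_mul hf (hgt.continuous.integrable_of_hasCompactSupport hcg) w
  have i4 : Integrable (fun x => lineDeriv ℝ f x w * g x) μ :=
    integrable_lineDeriv_mul hf (hg.continuous.integrable_of_hasCompactSupport h'g) w
  have l1 : ∫ x, t⁻¹ • (f (x + t • v) - f x) * lineDeriv ℝ g x w ∂μ =
      t⁻¹ * (∫ x, f (x + t • v) * lineDeriv ℝ g x w ∂μ - ∫ x, f x * lineDeriv ℝ g x w ∂μ) := by
    rw [← integral_sub i1 i2, ← integral_const_mul]
    refine integral_congr_ae (.of_forall fun x => ?_)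
    simp only [smul_eq_mul]; ring
  have l2 : ∫ x, t⁻¹ • (g (x + t • -v) - g x) * lineDeriv ℝ f x w ∂μ =
      t⁻¹ * (∫ x, lineDeriv ℝ f x w * g (x + t • -v) ∂μ - ∫ x, lineDeriv ℝ f x w * g x ∂μ) := by
    rw [← integral_sub i3 i4, ← integral_const_mul]
    refine integral_congr_ae (.of_forall fun x => ?_)
    simp only [smul_eq_mul]; ring
  rw [l1, l2, e1, e2]
  ring

end Lipschitz

/-- A bilinear bound from its weighted arithmetic-mean form. -/
theorem le_mul_of_forall_weighted {X κ a b : ℝ} (hκ : 0 ≤ κ) (ha : 0 ≤ a) (hb : 0 ≤ b)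
    (h : ∀ s : ℝ, 0 < s → X ≤ κ * (s / 2 * a ^ 2 + 1 / (2 * s) * b ^ 2)) : X ≤ κ * (a * b) := by
  have key : ∀ ε : ℝ, 0 < ε → X ≤ κ * ((a + ε) * (b + ε)) := by
    intro ε hε
    -- The optimal weight is `b / a`; the shift by `ε` keeps it defined and positive when `a` or `b`
    -- is zero.
    have hs := h ((b + ε) / (a + ε)) (by positivity)
    refine hs.trans (mul_le_mul_of_nonneg_left ?_ hκ)
    have e1 : (b + ε) / (a + ε) / 2 * a ^ 2 ≤ (a + ε) * (b + ε) / 2 := by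
      have : (b + ε) / (a + ε) / 2 * a ^ 2 ≤ (b + ε) / (a + ε) / 2 * (a + ε) ^ 2 := by
        gcongr; linarith
      refine this.trans (le_of_eq ?_)
      field_simp
    have e2 : 1 / (2 * ((b + ε) / (a + ε))) * b ^ 2 ≤ (a + ε) * (b + ε) / 2 := by
      have : 1 / (2 * ((b + ε) / (a + ε))) * b ^ 2 ≤
          1 / (2 * ((b + ε) / (a + ε))) * (b + ε) ^ 2 := by
        gcongr; linarith
      refine this.trans (le_of_eq ?_)
      field_simp
    linarith
  have hlim : Tendsto (fun ε : ℝ => κ * ((a + ε) * (b + ε))) (𝓝[>] 0) (𝓝 (κ * (a * b))) := by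
    have : Continuous fun ε : ℝ => κ * ((a + ε) * (b + ε)) := by fun_prop
    simpa using this.continuousWithinAt.tendsto (x := 0) (s := Set.Ioi 0)
  exact ge_of_tendsto hlim (by filter_upwards [self_mem_nhdsWithin] with ε hε using key ε hε)

/-! ### Geometry of the mesh -/

namespace Mesh

variable {d : ℕ} (M : Mesh d)

theorem convex_cell (e : Fin M.numElems) : Convex ℝ (M.cell e) := convex_convexHull ℝ _

theorem isCompact_cell (e : Fin M.numElems) : IsCompact (M.cell e) :=
  (Set.finite_range _).isCompact_convexHull ℝ

theorem interior_cell_nonempty (e : Fin M.numElems) : (interior (M.cell e)).Nonempty := by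
  rw [cell, interior_convexHull_nonempty_iff_affineSpan_eq_top]
  exact (M.elem e).span_eq_top (by simp)

theorem closure_interior_cell (e : Fin M.numElems) : closure (interior (M.cell e)) = M.cell e := by
  rw [(M.convex_cell e).closure_interior_eq_closure_of_nonempty_interior
    (M.interior_cell_nonempty e), (M.isCompact_cell e).isClosed.closure_eq]

theorem isOpen_domain : IsOpen M.domain := isOpen_interior

theorem interior_cell_subset_domain (e : Fin M.numElems) : interior (M.cell e) ⊆ M.domain :=
  interior_mono (Set.subset_iUnion _ e)

theorem cell_subset_closure_domain (e : Fin M.numElems) : M.cell e ⊆ closure M.domain := by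
  rw [← M.closure_interior_cell e]
  exact closure_mono (M.interior_cell_subset_domain e)

theorem isCompact_iUnion_cell : IsCompact (⋃ e, M.cell e) :=
  isCompact_iUnion fun e => M.isCompact_cell e

theorem closure_domain_subset : closure M.domain ⊆ ⋃ e, M.cell e :=
  closure_minimal interior_subset M.isCompact_iUnion_cell.isClosed

theorem isCompact_closure_domain : IsCompact (closure M.domain) :=
  M.isCompact_iUnion_cell.of_isClosed_subset isClosed_closure M.closure_domain_subset

theorem mem_bdry_of_notMem {x : Sp d} (h : x ∈ closure M.domain) (h' : x ∉ M.domain) :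
    x ∈ M.bdry := by
  rw [bdry, M.isOpen_domain.frontier_eq]
  exact ⟨h, h'⟩

theorem affineSpan_ne_top_of_ssubset (e : Fin M.numElems) {s : Set (Sp d)}
    (hs : s ⊆ Set.range (M.elem e).points) (hne : s ≠ Set.range (M.elem e).points) :
    affineSpan ℝ s ≠ ⊤ := by
  intro htop
  obtain ⟨x, hx, hxs⟩ : ∃ x ∈ Set.range (M.elem e).points, x ∉ s := by
    by_contra! h
    exact hne (hs.antisymm h)
  obtain ⟨i, rfl⟩ := hx
  have h1 : s ⊆ (M.elem e).points '' {i}ᶜ := by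
    intro y hy
    obtain ⟨j, rfl⟩ := hs hy
    exact ⟨j, fun h => hxs (by rwa [← (show j = i from h)]), rfl⟩
  have h2 : (M.elem e).points i ∈ affineSpan ℝ ((M.elem e).points '' {i}ᶜ) :=
    affineSpan_mono ℝ h1 (htop ▸ AffineSubspace.mem_top ℝ _ _)
  exact ((M.elem e).mem_affineSpan_image_iff.1 h2) rfl

/-- By conformity, an overlap with interior would be the hull of the common vertices. These would
then affinely span the space, hence be all the vertices of both elements, against distinctness. -/
theorem disjoint_interior_cell {e e' : Fin M.numElems} (h : e ≠ e') :
    Disjoint (interior (M.cell e)) (interior (M.cell e')) := by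
  rw [Set.disjoint_iff_inter_eq_empty, ← interior_inter, cell, cell, M.conforming,
    ← Set.not_nonempty_iff_eq_empty, interior_convexHull_nonempty_iff_affineSpan_eq_top]
  intro htop
  have h1 : Set.range (M.elem e).points ∩ Set.range (M.elem e').points =
      Set.range (M.elem e).points := by
    by_contra hne
    exact M.affineSpan_ne_top_of_ssubset e Set.inter_subset_left hne htop
  have h2 : Set.range (M.elem e).points ∩ Set.range (M.elem e').points =
      Set.range (M.elem e').points := by
    by_contra hne
    exact M.affineSpan_ne_top_of_ssubset e' Set.inter_subset_right hne htop
  exact M.distinct e e' h (h1.symm.trans h2)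

theorem volume_frontier_cell (e : Fin M.numElems) : volume (frontier (M.cell e)) = 0 :=
  (M.convex_cell e).addHaar_frontier _

theorem volume_diff_iUnion_interior_cell :
    volume ((⋃ e, M.cell e) \ ⋃ e, interior (M.cell e)) = 0 := by
  refine measure_mono_null (t := ⋃ e, frontier (M.cell e)) ?_
    (measure_iUnion_null fun e => M.volume_frontier_cell e)
  rintro x ⟨hx, hx'⟩
  obtain ⟨e, he⟩ := Set.mem_iUnion.1 hx
  refine Set.mem_iUnion.2 ⟨e, ?_⟩
  rw [(M.isCompact_cell e).isClosed.frontier_eq]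
  exact ⟨he, fun h => hx' (Set.mem_iUnion.2 ⟨e, h⟩)⟩

theorem iUnion_interior_cell_ae_eq_domain : (⋃ e, interior (M.cell e)) =ᵐ[volume] M.domain := by
  refine (ae_eq_set).2 ⟨?_, ?_⟩
  · rw [Set.sdiff_eq_empty.2 (Set.iUnion_subset M.interior_cell_subset_domain), measure_empty]
  · exact measure_mono_null (Set.sdiff_subset_sdiff_left interior_subset)
      M.volume_diff_iUnion_interior_cell

/-- Γ lies in the union of the element frontiers, which are null because the elements are convex. -/
theorem volume_bdry : volume M.bdry = 0 := by
  refine measure_mono_null ?_ M.volume_diff_iUnion_interior_cell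
  intro x hx
  rw [bdry, M.isOpen_domain.frontier_eq] at hx
  refine ⟨M.closure_domain_subset hx.1, fun h => hx.2 ?_⟩
  obtain ⟨e, he⟩ := Set.mem_iUnion.1 h
  exact M.interior_cell_subset_domain e he

/-- To prove an almost everywhere statement on `Ω`, it suffices to treat element interiors. -/
theorem ae_domain_of_forall_interior {p : Sp d → Prop}
    (h : ∀ e, ∀ x ∈ interior (M.cell e), p x) : ∀ᵐ x ∂volume.restrict M.domain, p x := by
  rw [← Measure.restrict_congr_set M.iUnion_interior_cell_ae_eq_domain]
  refine (ae_restrict_iff' (MeasurableSet.iUnion fun e => isOpen_interior.measurableSet)).2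
    (.of_forall fun x hx => ?_)
  obtain ⟨e, he⟩ := Set.mem_iUnion.1 hx
  exact h e x he

theorem face_subset_cell (e : Fin M.numElems) (i : Fin (d + 1)) : M.face e i ⊆ M.cell e :=
  convexHull_mono (Set.image_subset_range _ _)

theorem isCompact_face (e : Fin M.numElems) (i : Fin (d + 1)) : IsCompact (M.face e i) :=
  (Set.toFinite _).isCompact_convexHull ℝ

theorem elemSize_pos [NeZero d] (e : Fin M.numElems) : 0 < M.elemSize e := by
  refine Metric.diam_pos ?_ (M.isCompact_cell e).isBounded
  refine ⟨_, subset_convexHull ℝ _ ⟨0, rfl⟩, _, subset_convexHull ℝ _ ⟨Fin.last d, rfl⟩, ?_⟩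
  intro h
  have := (M.elem e).independent.injective h
  rw [Fin.ext_iff] at this
  exact NeZero.ne d (by simpa using this.symm)

theorem elemSize_le_size (e : Fin M.numElems) : M.elemSize e ≤ M.size :=
  le_ciSup (Set.finite_range M.elemSize).bddAbove e

theorem size_pos [NeZero d] : 0 < M.size :=
  (M.elemSize_pos ⟨0, M.numElems_pos⟩).trans_le (M.elemSize_le_size _)

end Mesh

/-! ### Surface measure of a face -/

/-- A constant bounding the measure of an `m`-simplex in terms of its diameter. -/
noncomputable def simplexConst (m : ℕ) : ℝ :=
  (μHE[m] (Set.univ.pi fun _ : Fin m => Set.Icc (0 : ℝ) 1)).toReal * (m : ℝ) ^ m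

theorem euclideanHausdorffMeasure_cube_ne_top (m : ℕ) :
    (μHE[m] (Set.univ.pi fun _ : Fin m => Set.Icc (0 : ℝ) 1)) ≠ ∞ := by
  have h : (Set.univ.pi fun _ : Fin m => Set.Icc (0 : ℝ) 1) = Set.Icc 0 1 := by
    ext x; simp [Pi.le_def]
  have := isAddHaarMeasure_euclideanHausdorffMeasure (E := Fin m → ℝ)
  rw [Module.finrank_fin_fun] at this
  rw [h]
  exact (isCompact_Icc (a := (0 : Fin m → ℝ)) (b := 1)).measure_ne_top

theorem euclideanHausdorffMeasure_image_le {X Y : Type*} [MetricSpace X]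
    [MeasurableSpace X] [BorelSpace X] [MetricSpace Y] [MeasurableSpace Y] [BorelSpace Y]
    {K : ℝ≥0} {f : X → Y} (h : LipschitzWith K f) (m : ℕ) (s : Set X) :
    μHE[m] (f '' s) ≤ (K : ℝ≥0∞) ^ m * μHE[m] s := by
  simp_rw [Measure.euclideanHausdorffMeasure_def, Measure.smul_apply, ENNReal.smul_def, smul_eq_mul]
  have := h.hausdorffMeasure_image_le (d := m) (Nat.cast_nonneg m) s
  rw [ENNReal.rpow_natCast] at this
  calc _ ≤ _ := mul_le_mul_right this _
    _ = _ := by ring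

/-- A simplex lies in the parallelepiped spanned by its edges at `q 0`. The crude enclosure suffices
since only an upper bound on the surface measure is wanted. -/
theorem convexHull_range_subset_image_cube {E : Type*} [NormedAddCommGroup E] [NormedSpace ℝ E]
    {m : ℕ} (q : Fin (m + 1) → E) :
    convexHull ℝ (Set.range q) ⊆
      (fun t : Fin m → ℝ => q 0 + ∑ j, t j • (q j.succ - q 0)) ''
        (Set.univ.pi fun _ : Fin m => Set.Icc (0 : ℝ) 1) := by
  have hconv : Convex ℝ (Set.univ.pi fun _ : Fin m => Set.Icc (0 : ℝ) 1) :=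
    convex_pi fun _ _ => convex_Icc 0 1
  have hlin := (hconv.linear_image
    (Fintype.linearCombination ℝ fun j : Fin m => q j.succ - q 0)).translate (q 0)
  rw [Set.image_image] at hlin
  simp only [Fintype.linearCombination_apply] at hlin
  refine convexHull_min ?_ hlin
  rintro _ ⟨j, rfl⟩
  refine Fin.cases ?_ (fun j => ?_) j
  · exact ⟨0, fun _ _ => ⟨le_rfl, zero_le_one⟩, by simp⟩
  · refine ⟨Pi.single j 1, fun i _ => ?_, ?_⟩
    · rcases eq_or_ne i j with rfl | h <;> simp [*]
    · simp [Pi.single_apply]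

theorem lipschitzWith_cube_map {E : Type*} [NormedAddCommGroup E] [NormedSpace ℝ E]
    {m : ℕ} (q : Fin (m + 1) → E) {δ : ℝ≥0} (hδ : ∀ j : Fin m, ‖q j.succ - q 0‖ ≤ δ) :
    LipschitzWith (m * δ) (fun t : Fin m → ℝ => q 0 + ∑ j, t j • (q j.succ - q 0)) := by
  refine LipschitzWith.of_dist_le_mul fun s t => ?_
  rw [dist_eq_norm, add_sub_add_left_eq_sub, ← Finset.sum_sub_distrib]
  refine (norm_sum_le _ _).trans ?_
  have : ∀ j ∈ (Finset.univ : Finset (Fin m)),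
      ‖s j • (q j.succ - q 0) - t j • (q j.succ - q 0)‖ ≤ dist s t * δ := by
    intro j _
    rw [← sub_smul, norm_smul]
    refine mul_le_mul ?_ (hδ j) (norm_nonneg _) dist_nonneg
    simpa [Real.dist_eq] using dist_le_pi_dist s t j
  refine (Finset.sum_le_card_nsmul _ _ _ this).trans (le_of_eq ?_)
  simp; ring

/-- The face is covered by the image of a unit cube of dimension `d - 1` under a map with Lipschitz
constant `(d - 1)` times the diameter, and Hausdorff measure scales with the corresponding power of
it. -/
theorem euclideanHausdorffMeasure_face_le {d : ℕ} [NeZero d] (q : Fin (d + 1) → Sp d)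
    (i : Fin (d + 1)) :
    μHE[d - 1] (convexHull ℝ (q '' {i}ᶜ)) ≤
      ENNReal.ofReal (simplexConst (d - 1) * Metric.diam (convexHull ℝ (Set.range q)) ^ (d - 1)) := by
  obtain ⟨m, rfl⟩ : ∃ m, d = m + 1 := ⟨d - 1, (Nat.succ_pred (NeZero.ne d)).symm⟩
  set δ := Metric.diam (convexHull ℝ (Set.range q)) with hδ
  have hδ0 : 0 ≤ δ := Metric.diam_nonneg
  have hr : q '' {i}ᶜ = Set.range (q ∘ i.succAbove) := by
    rw [Set.range_comp, Fin.range_succAbove]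
  have hq : ∀ a b, ‖q a - q b‖ ≤ δ.toNNReal := fun a b => by
    rw [← dist_eq_norm, Real.coe_toNNReal _ hδ0]
    exact Metric.dist_le_diam_of_mem ((Set.finite_range q).isCompact_convexHull ℝ).isBounded
      (subset_convexHull ℝ _ ⟨a, rfl⟩) (subset_convexHull ℝ _ ⟨b, rfl⟩)
  have hL := lipschitzWith_cube_map (q ∘ i.succAbove) (fun j => hq _ _)
  rw [hr]
  refine (measure_mono (convexHull_range_subset_image_cube (q ∘ i.succAbove))).trans
    ((euclideanHausdorffMeasure_image_le hL m _).trans (le_of_eq ?_))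
  have hfin := euclideanHausdorffMeasure_cube_ne_top m
  rw [Nat.add_sub_cancel, simplexConst, mul_assoc, ← mul_pow,
    ENNReal.ofReal_mul ENNReal.toReal_nonneg, ENNReal.ofReal_toReal hfin, mul_comm,
    ENNReal.ofReal_pow (by positivity), ENNReal.ofReal_mul (by positivity)]
  simp [ENNReal.ofReal]

namespace Mesh

variable {d : ℕ} (M : Mesh d)

theorem measure_face_le [NeZero d] (e : Fin M.numElems) (i : Fin (d + 1)) :
    μHE[d - 1] (M.face e i) ≤ ENNReal.ofReal (simplexConst (d - 1) * M.elemSize e ^ (d - 1)) :=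
  euclideanHausdorffMeasure_face_le _ i

theorem measure_face_lt_top [NeZero d] (e : Fin M.numElems) (i : Fin (d + 1)) :
    μHE[d - 1] (M.face e i) < ∞ :=
  (M.measure_face_le e i).trans_lt ENNReal.ofReal_lt_top

theorem integrableOn_face [NeZero d] (e : Fin M.numElems) (i : Fin (d + 1)) {f : Sp d → ℝ}
    (hf : Continuous f) : IntegrableOn f (M.face e i) μHE[d - 1] := by
  obtain ⟨C, hC⟩ := (M.isCompact_face e i).exists_bound_of_continuousOn hf.continuousOn
  exact Measure.integrableOn_of_bounded (M.measure_face_lt_top e i).ne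
    hf.aestronglyMeasurable ((ae_restrict_iff' (M.isCompact_face e i).measurableSet).2
      (.of_forall hC))

/-! ### Piecewise continuous functions -/

/-- `f` agrees in the interior of each element with a function that is continuous everywhere. -/
def PiecewiseCont {α : Type*} [TopologicalSpace α] (f : Sp d → α) : Prop :=
  ∀ e, ∃ g : Sp d → α, Continuous g ∧ Set.EqOn f g (interior (M.cell e))

variable {M}

namespace PiecewiseCont

variable {α β γ : Type*} [TopologicalSpace α] [TopologicalSpace β] [TopologicalSpace γ]

theorem comp {f : Sp d → α} (hf : M.PiecewiseCont f) {φ : α → β} (hφ : Continuous φ) :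
    M.PiecewiseCont fun x => φ (f x) := fun e => by
  obtain ⟨g, hg, h⟩ := hf e
  exact ⟨fun x => φ (g x), hφ.comp hg, fun x hx => congrArg φ (h hx)⟩

theorem comp₂ {f : Sp d → α} {f' : Sp d → β} (hf : M.PiecewiseCont f) (hf' : M.PiecewiseCont f')
    {φ : α → β → γ} (hφ : Continuous fun p : α × β => φ p.1 p.2) :
    M.PiecewiseCont fun x => φ (f x) (f' x) := fun e => by
  obtain ⟨g, hg, h⟩ := hf e
  obtain ⟨g', hg', h'⟩ := hf' e
  exact ⟨fun x => φ (g x) (g' x), hφ.comp (hg.prodMk hg'), fun x hx => by simp only [h hx, h' hx]⟩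

/-- The union of the element boundaries is null, and on each compact element a continuous
representative is integrable. -/
theorem integrableOn_domain {F : Type*} [NormedAddCommGroup F] {f : Sp d → F}
    (hf : M.PiecewiseCont f) : IntegrableOn f M.domain := by
  refine IntegrableOn.congr_set_ae ?_ M.iUnion_interior_cell_ae_eq_domain.symm
  refine integrableOn_finite_iUnion.2 fun e => ?_
  obtain ⟨g, hg, h⟩ := hf e
  exact ((hg.continuousOn.integrableOn_compact (M.isCompact_cell e)).mono_set
    interior_subset).congr_fun h.symm isOpen_interior.measurableSet

end PiecewiseCont

/-- Integrals over `Ω` are sums of integrals over the elements. -/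
theorem integral_domain_eq_sum {f : Sp d → ℝ} (hf : M.PiecewiseCont f) :
    ∫ x in M.domain, f x = ∑ e, ∫ x in interior (M.cell e), f x := by
  rw [← setIntegral_congr_set M.iUnion_interior_cell_ae_eq_domain]
  have h := hf.integrableOn_domain.congr_set_ae M.iUnion_interior_cell_ae_eq_domain
  rw [integral_iUnion_fintype (fun e => isOpen_interior.measurableSet)
    (fun e e' h => M.disjoint_interior_cell h)
    (fun e => h.mono_set (Set.subset_iUnion (fun e => interior (M.cell e)) e))]

theorem integral_interior_cell (e : Fin M.numElems) (f : Sp d → ℝ) :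
    ∫ x in interior (M.cell e), f x = ∫ x in M.cell e, f x :=
  setIntegral_congr_set (interior_ae_eq_of_null_frontier (M.volume_frontier_cell e))

end Mesh

/-! ### Continuous piecewise smooth functions vanishing on the boundary -/

namespace Mesh

variable {d : ℕ} {M : Mesh d}

/-- Continuous functions on `ℝ^d` that vanish off `Ω` and are `C¹` on every closed element. -/
structure ZeroBdry (M : Mesh d) (f : Sp d → ℝ) : Prop where
  continuous : Continuous f
  eq_zero : ∀ x ∉ M.domain, f x = 0
  smooth : ∀ e, ∃ g : Sp d → ℝ, ContDiff ℝ 1 g ∧ Set.EqOn f g (M.cell e)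

namespace ZeroBdry

variable {f g : Sp d → ℝ}

theorem mul (hf : M.ZeroBdry f) (hg : M.ZeroBdry g) : M.ZeroBdry fun x => f x * g x where
  continuous := hf.continuous.mul hg.continuous
  eq_zero x hx := by simp [hf.eq_zero x hx]
  smooth e := by
    obtain ⟨f', hf', h⟩ := hf.smooth e
    obtain ⟨g', hg', h'⟩ := hg.smooth e
    exact ⟨fun x => f' x * g' x, hf'.mul hg', fun x hx => by simp only [h hx, h' hx]⟩

theorem hasCompactSupport (hf : M.ZeroBdry f) : HasCompactSupport f :=
  .intro M.isCompact_closure_domain fun x hx => hf.eq_zero x fun h => hx (subset_closure h)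

/-- Near `x`, a point `y` of Ω lies in an element that also contains `x`, so that element's
Lipschitz constant applies. The sum of the constants serves for all elements at once. -/
theorem exists_lipschitzWith (hf : M.ZeroBdry f) : ∃ K, LipschitzWith K f := by
  have h : ∀ e, ∃ K, LipschitzOnWith K f (M.cell e) := fun e => by
    obtain ⟨g, hg, hfg⟩ := hf.smooth e
    obtain ⟨K, hK⟩ := hg.contDiffOn.exists_lipschitzOnWith one_ne_zero (M.convex_cell e)
      (M.isCompact_cell e)
    exact ⟨K, fun x hx y hy => by rw [hfg hx, hfg hy]; exact hK hx hy⟩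
  choose K hK using h
  refine ⟨∑ e, K e, lipschitzWith_of_eventually_norm_sub_le hf.continuous _ fun x => ?_⟩
  have hcell : ∀ᶠ y in 𝓝 x, ∀ e, y ∈ M.cell e → x ∈ M.cell e := by
    refine eventually_all.2 fun e => ?_
    by_cases hx : x ∈ M.cell e
    · exact .of_forall fun _ _ => hx
    · filter_upwards [(M.isCompact_cell e).isClosed.isOpen_compl.mem_nhds hx] with y hy h
      exact absurd h hy
  -- Used in contrapositive form: if a nearby `y` is outside Ω, so is `x`, and `f` vanishes at both.
  have hdom : ∀ᶠ y in 𝓝 x, x ∈ M.domain → y ∈ M.domain := by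
    by_cases hx : x ∈ M.domain
    · filter_upwards [M.isOpen_domain.mem_nhds hx] with y hy _ using hy
    · exact .of_forall fun _ h => absurd h hx
  filter_upwards [hcell, hdom] with y hy hy'
  by_cases hyd : y ∈ M.domain
  · obtain ⟨e, he⟩ := Set.mem_iUnion.1 (interior_subset hyd)
    have := (hK e).dist_le_mul y he x (hy e he)
    rw [Real.dist_eq, dist_eq_norm] at this
    refine this.trans (mul_le_mul_of_nonneg_right ?_ (norm_nonneg _))
    exact_mod_cast Finset.single_le_sum (f := K) (fun _ _ => zero_le) (Finset.mem_univ e)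
  · rw [hf.eq_zero y hyd, hf.eq_zero x fun h => hyd (hy' h)]
    simp only [sub_zero, abs_zero]
    positivity

theorem lineDeriv_eq_zero (hf : M.ZeroBdry f) {x : Sp d} (hx : x ∉ closure M.domain) (v : Sp d) :
    lineDeriv ℝ f x v = 0 := by
  refine lineDeriv_eq_zero_of_notMem_tsupport (fun h => hx ?_) v
  exact closure_mono (fun y hy => by
    by_contra h'
    exact hy (hf.eq_zero y h')) h

theorem setIntegral_domain_eq {h : Sp d → ℝ} (hh : ∀ x ∉ closure M.domain, h x = 0) :
    ∫ x in M.domain, h x = ∫ x, h x := by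
  rw [← setIntegral_eq_integral_of_forall_compl_eq_zero (μ := volume) (f := h) hh]
  refine setIntegral_congr_set (ae_eq_set.2 ⟨?_, ?_⟩)
  · rw [Set.sdiff_eq_empty.2 subset_closure, measure_empty]
  · refine measure_mono_null (fun x hx => ?_) M.volume_bdry
    exact M.mem_bdry_of_notMem hx.1 hx.2

/-- The divergence theorem with neither boundary nor interelement terms, since `f` is Lipschitz with
compact support on the whole space. -/
theorem integral_lineDeriv (hf : M.ZeroBdry f) (v : Sp d) :
    ∫ x in M.domain, lineDeriv ℝ f x v = 0 := by
  obtain ⟨K, hK⟩ := hf.exists_lipschitzWith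
  rw [setIntegral_domain_eq fun x hx => hf.lineDeriv_eq_zero hx v]
  exact integral_lineDeriv_eq_zero hK hf.hasCompactSupport v

theorem integral_lineDeriv_mul_comm (hf : M.ZeroBdry f) (hg : M.ZeroBdry g) (v w : Sp d) :
    ∫ x in M.domain, lineDeriv ℝ f x v * lineDeriv ℝ g x w =
      ∫ x in M.domain, lineDeriv ℝ f x w * lineDeriv ℝ g x v := by
  obtain ⟨K, hK⟩ := hf.exists_lipschitzWith
  obtain ⟨L, hL⟩ := hg.exists_lipschitzWith
  rw [setIntegral_domain_eq fun x hx => by rw [hf.lineDeriv_eq_zero hx v, zero_mul],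
    setIntegral_domain_eq fun x hx => by rw [hf.lineDeriv_eq_zero hx w, zero_mul]]
  exact integral_lineDeriv_mul_lineDeriv_comm hK hf.hasCompactSupport hL hg.hasCompactSupport v w

end ZeroBdry

end Mesh

/-! ### Finite element functions -/

/-- The vector field on `ℝ^d` with polynomial components. -/
noncomputable def polyVec {d : ℕ} (P : Fin d → MvPolynomial (Fin d) ℝ) (x : Sp d) : Sp d :=
  WithLp.toLp 2 fun i => polyFun (P i) x

theorem contDiff_polyVec {d : ℕ} (P : Fin d → MvPolynomial (Fin d) ℝ) :
    ContDiff ℝ 1 (polyVec P) :=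
  contDiff_euclidean.2 fun i => contDiff_polyFun (P i)

theorem fderiv_polyVec_apply {d : ℕ} (P : Fin d → MvPolynomial (Fin d) ℝ) (x v : Sp d)
    (i : Fin d) : fderiv ℝ (polyVec P) x v i = fderiv ℝ (polyFun (P i)) x v := by
  have h := ((contDiff_polyVec P).differentiable one_ne_zero x).hasFDerivAt
  have h2 := (EuclideanSpace.proj i : Sp d →L[ℝ] ℝ).hasFDerivAt.comp x h
  exact (congrArg (fun A => A v) h2.fderiv).symm

theorem fderiv_polyFun_basisVec {d : ℕ} (P : MvPolynomial (Fin d) ℝ) (x : Sp d) (j : Fin d) :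
    fderiv ℝ (polyFun P) x (basisVec j) = polyFun (MvPolynomial.pderiv j P) x := by
  rw [(hasFDerivAt_polyFun P x).fderiv]
  simp [basisVec]

namespace Mesh

variable {d : ℕ} {M : Mesh d} {k : ℕ} {u w : Sp d → Sp d}

theorem velocitySpace_combination (hu : u ∈ M.velocitySpace k) (hw : w ∈ M.velocitySpace k)
    (a b : ℝ) : a • u + b • w ∈ M.velocitySpace k := by
  refine ⟨fun i => ⟨?_, fun e => ?_⟩, fun x hx => by simp [hu.2 x hx, hw.2 x hx]⟩
  · exact ((hu.1 i).1.const_smul a).add ((hw.1 i).1.const_smul b)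
  · obtain ⟨P, hP, hPu⟩ := (hu.1 i).2 e
    obtain ⟨R, hR, hRw⟩ := (hw.1 i).2 e
    refine ⟨a • P + b • R, ?_, fun x hx => by simp [hPu x hx, hRw x hx]⟩
    exact (MvPolynomial.totalDegree_add _ _).trans
      (max_le ((MvPolynomial.totalDegree_smul_le _ _).trans hP)
        ((MvPolynomial.totalDegree_smul_le _ _).trans hR))

theorem exists_polyVec (hu : u ∈ M.velocitySpace k) (e : Fin M.numElems) :
    ∃ P : Fin d → MvPolynomial (Fin d) ℝ, (∀ i, (P i).totalDegree ≤ k) ∧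
      Set.EqOn u (polyVec P) (M.cell e) := by
  choose P hP h using fun i => (hu.1 i).2 e
  refine ⟨P, hP, fun x hx => ?_⟩
  ext i
  exact h i x hx

theorem eventuallyEq_of_mem_interior {F : Type*} {f g : Sp d → F} {e : Fin M.numElems}
    (h : Set.EqOn f g (M.cell e)) {x : Sp d} (hx : x ∈ interior (M.cell e)) : f =ᶠ[𝓝 x] g :=
  h.eventuallyEq_of_mem (mem_interior_iff_mem_nhds.1 hx)

theorem differentiableAt_velocity (hu : u ∈ M.velocitySpace k) {e : Fin M.numElems} {x : Sp d}
    (hx : x ∈ interior (M.cell e)) : DifferentiableAt ℝ u x := by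
  obtain ⟨P, -, h⟩ := exists_polyVec hu e
  exact ((contDiff_polyVec P).differentiable one_ne_zero x).congr_of_eventuallyEq
    (eventuallyEq_of_mem_interior h hx)

theorem piecewiseCont_velocity (hu : u ∈ M.velocitySpace k) : M.PiecewiseCont u := fun e => by
  obtain ⟨P, -, h⟩ := exists_polyVec hu e
  exact ⟨polyVec P, (contDiff_polyVec P).continuous, h.mono interior_subset⟩

theorem piecewiseCont_fderiv_velocity (hu : u ∈ M.velocitySpace k) :
    M.PiecewiseCont (fderiv ℝ u) := fun e => by
  obtain ⟨P, -, h⟩ := exists_polyVec hu e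
  exact ⟨fderiv ℝ (polyVec P), (contDiff_polyVec P).continuous_fderiv one_ne_zero,
    fun x hx => (eventuallyEq_of_mem_interior h hx).fderiv_eq⟩

theorem piecewiseCont_gradTensor (hu : u ∈ M.velocitySpace k) :
    M.PiecewiseCont (gradTensor u) :=
  (piecewiseCont_fderiv_velocity hu).comp (φ := fun A : Sp d →L[ℝ] Sp d =>
    (WithLp.toLp 2 fun ij : Fin d × Fin d => (A (basisVec ij.2)) ij.1)) (by fun_prop)

theorem piecewiseCont_div (hu : u ∈ M.velocitySpace k) : M.PiecewiseCont (div u) :=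
  (piecewiseCont_fderiv_velocity hu).comp (φ := fun A : Sp d →L[ℝ] Sp d =>
    ∑ i, (A (basisVec i)) i) (by fun_prop)

theorem piecewiseCont_gradient {p : Sp d → ℝ} (hp : p ∈ M.lagrange k) :
    M.PiecewiseCont (gradient p) := fun e => by
  obtain ⟨P, -, h⟩ := hp.2 e
  refine ⟨gradient (polyFun P), ?_, fun x hx => ?_⟩
  · exact (InnerProductSpace.toDual ℝ (Sp d)).symm.continuous.comp
      ((contDiff_polyFun P).continuous_fderiv one_ne_zero)
  · have : p =ᶠ[𝓝 x] polyFun P := eventuallyEq_of_mem_interior h hx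
    rw [gradient, gradient, this.fderiv_eq]

/-- The extension of the `i`-th component of a velocity by zero. -/
noncomputable def ext (M : Mesh d) (u : Sp d → Sp d) (i : Fin d) : Sp d → ℝ :=
  M.domain.indicator fun x => u x i

theorem zeroBdry_ext (hu : u ∈ M.velocitySpace k) (i : Fin d) : M.ZeroBdry (M.ext u i) where
  continuous := continuous_indicator (fun x hx => by simp [hu.2 x hx]) (hu.1 i).1
  eq_zero x hx := Set.indicator_of_notMem hx _
  smooth e := by
    obtain ⟨P, -, h⟩ := (hu.1 i).2 e
    refine ⟨polyFun P, contDiff_polyFun P, fun x hx => ?_⟩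
    by_cases hxd : x ∈ M.domain
    · rw [ext, Set.indicator_of_mem hxd]; exact h x hx
    · rw [ext, Set.indicator_of_notMem hxd]
      -- A point of a closed element outside the open set Ω lies on Γ, where `u` and hence its
      -- polynomial representative vanish. The extension thus agrees with the polynomial on the
      -- whole closed element.
      have := hu.2 x (M.mem_bdry_of_notMem (M.cell_subset_closure_domain e hx) hxd)
      have h2 := h x hx
      simp only [this] at h2
      exact h2

theorem hasFDerivAt_ext (hu : u ∈ M.velocitySpace k) (i : Fin d) {e : Fin M.numElems} {x : Sp d}
    (hx : x ∈ interior (M.cell e)) :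
    HasFDerivAt (M.ext u i) ((EuclideanSpace.proj i : Sp d →L[ℝ] ℝ).comp (fderiv ℝ u x)) x := by
  have h1 := (differentiableAt_velocity hu hx).hasFDerivAt
  have h2 := (EuclideanSpace.proj i : Sp d →L[ℝ] ℝ).hasFDerivAt.comp x h1
  refine h2.congr_of_eventuallyEq ?_
  filter_upwards [M.isOpen_domain.mem_nhds (M.interior_cell_subset_domain e hx)] with y hy
  simp [ext, Set.indicator_of_mem hy]

theorem ext_eq_of_mem_interior {e : Fin M.numElems} {x : Sp d} (hx : x ∈ interior (M.cell e))
    (i : Fin d) : M.ext u i x = u x i :=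
  Set.indicator_of_mem (M.interior_cell_subset_domain e hx) _

theorem lineDeriv_ext (hu : u ∈ M.velocitySpace k) (i : Fin d) {e : Fin M.numElems} {x : Sp d}
    (hx : x ∈ interior (M.cell e)) (v : Sp d) :
    lineDeriv ℝ (M.ext u i) x v = fderiv ℝ u x v i :=
  ((hasFDerivAt_ext hu i hx).hasLineDerivAt v).lineDeriv

/-- The integrand is half the divergence of |u|² w, whose integral vanishes by the boundary values.
The term with div w / 2 makes this exact for fields `w` that are not solenoidal. -/
theorem l2Inner_conv_self (hw : w ∈ M.velocitySpace k) (hu : u ∈ M.velocitySpace k) :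
    l2Inner M.domain (fun x => conv w u x + (div w x / 2) • u x) u = 0 := by
  have hF : ∀ i j, M.ZeroBdry fun x => M.ext w j x * (M.ext u i x * M.ext u i x) := fun i j =>
    (zeroBdry_ext hw j).mul ((zeroBdry_ext hu i).mul (zeroBdry_ext hu i))
  have hder : ∀ i j e, ∀ x ∈ interior (M.cell e),
      lineDeriv ℝ (fun x => M.ext w j x * (M.ext u i x * M.ext u i x)) x (basisVec j) =
        fderiv ℝ w x (basisVec j) j * (u x i * u x i) +
          2 * (w x j * (u x i * fderiv ℝ u x (basisVec j) i)) := by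
    intro i j e x hx
    have hd := ((hasFDerivAt_ext hw j hx).mul
      ((hasFDerivAt_ext hu i hx).mul (hasFDerivAt_ext hu i hx))).hasLineDerivAt (basisVec j)
    refine hd.lineDeriv.trans ?_
    simp only [Pi.mul_apply, ext_eq_of_mem_interior hx, _root_.add_apply, _root_.smul_apply, smul_eq_mul,
      ContinuousLinearMap.comp_apply, PiLp.proj_apply]
    ring
  have hpw : ∀ i j, M.PiecewiseCont fun x => fderiv ℝ w x (basisVec j) j * (u x i * u x i) +
      2 * (w x j * (u x i * fderiv ℝ u x (basisVec j) i)) := fun i j =>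
    ((piecewiseCont_fderiv_velocity hw).comp₂ (piecewiseCont_velocity hu)
      (φ := fun A v => A (basisVec j) j * (v i * v i)) (by fun_prop)).comp₂
      (((piecewiseCont_velocity hw).comp₂ (piecewiseCont_velocity hu)
        (φ := fun a b => (a, b)) (by fun_prop)).comp₂ (piecewiseCont_fderiv_velocity hu)
        (φ := fun p A => 2 * (p.1 j * (p.2 i * A (basisVec j) i))) (by fun_prop))
      (φ := fun a b => a + b) (by fun_prop)
  have hzero : ∀ i j, ∫ x in M.domain, (fderiv ℝ w x (basisVec j) j * (u x i * u x i) +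
      2 * (w x j * (u x i * fderiv ℝ u x (basisVec j) i))) = 0 := fun i j => by
    rw [← (hF i j).integral_lineDeriv (basisVec j)]
    refine integral_congr_ae ?_
    filter_upwards [M.ae_domain_of_forall_interior (hder i j)] with x hx using hx.symm
  have hsum : ∫ x in M.domain, ∑ i, ∑ j, (fderiv ℝ w x (basisVec j) j * (u x i * u x i) +
      2 * (w x j * (u x i * fderiv ℝ u x (basisVec j) i))) = 0 := by
    rw [integral_finsetSum _ fun i _ => integrable_finsetSum _ fun j _ =>
      (hpw i j).integrableOn_domain]
    refine Finset.sum_eq_zero fun i _ => ?_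
    rw [integral_finsetSum _ fun j _ => (hpw i j).integrableOn_domain]
    exact Finset.sum_eq_zero fun j _ => hzero i j
  have hint : ∀ x, inner ℝ (conv w u x + (div w x / 2) • u x) (u x) =
      1 / 2 * ∑ i, ∑ j, (fderiv ℝ w x (basisVec j) j * (u x i * u x i) +
        2 * (w x j * (u x i * fderiv ℝ u x (basisVec j) i))) := by
    intro x
    have hexp : ∀ i, conv w u x i = ∑ j, w x j * fderiv ℝ u x (basisVec j) i := by
      intro i
      have hw' : w x = ∑ j, w x j • basisVec j := by
        ext i; simp [basisVec, Finset.sum_apply, Pi.single_apply]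
      rw [conv]
      conv_lhs => rw [hw']
      simp [map_sum]
    simp only [PiLp.inner_apply, PiLp.add_apply, PiLp.smul_apply, hexp, div, smul_eq_mul,
      RCLike.inner_apply, conj_trivial, Finset.mul_sum]
    refine Finset.sum_congr rfl fun i _ => ?_
    rw [mul_add, Finset.mul_sum, Finset.sum_div, Finset.sum_mul, Finset.mul_sum,
      ← Finset.sum_add_distrib]
    exact Finset.sum_congr rfl fun j _ => by ring
  rw [l2Inner]
  simp only [hint]
  rw [integral_const_mul, hsum, mul_zero]

end Mesh

/-! ### Square norms -/

section Norms

variable {d : ℕ} {F : Type*} [NormedAddCommGroup F]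

theorem l2Norm_nonneg (Ω : Set (Sp d)) (f : Sp d → F) : 0 ≤ l2Norm Ω f := Real.sqrt_nonneg _

theorem l2Norm_sq (Ω : Set (Sp d)) (f : Sp d → F) : l2Norm Ω f ^ 2 = ∫ x in Ω, ‖f x‖ ^ 2 :=
  Real.sq_sqrt (integral_nonneg fun _ => sq_nonneg _)

theorem l2Inner_self [InnerProductSpace ℝ F] (Ω : Set (Sp d)) (f : Sp d → F) :
    l2Inner Ω f f = l2Norm Ω f ^ 2 := by
  rw [l2Norm_sq, l2Inner]
  simp only [real_inner_self_eq_norm_sq]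

end Norms

namespace Mesh

variable {d : ℕ} {M : Mesh d} {k : ℕ} {u w : Sp d → Sp d}

namespace PiecewiseCont

variable {F : Type*} [NormedAddCommGroup F] {f g : Sp d → F}

theorem norm_sq (hf : M.PiecewiseCont f) : M.PiecewiseCont fun x => ‖f x‖ ^ 2 :=
  hf.comp (φ := fun v : F => ‖v‖ ^ 2) (by fun_prop)

theorem norm_mul_norm {G : Type*} [NormedAddCommGroup G] {g : Sp d → G}
    (hf : M.PiecewiseCont f) (hg : M.PiecewiseCont g) :
    M.PiecewiseCont fun x => ‖f x‖ * ‖g x‖ :=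
  hf.comp₂ hg (φ := fun (v : F) (w : G) => ‖v‖ * ‖w‖) (by fun_prop)

/-- The Cauchy–Schwarz inequality on `Ω`. -/
theorem integral_norm_mul_norm_le {G : Type*} [NormedAddCommGroup G] {g : Sp d → G}
    (hf : M.PiecewiseCont f) (hg : M.PiecewiseCont g) :
    ∫ x in M.domain, ‖f x‖ * ‖g x‖ ≤ l2Norm M.domain f * l2Norm M.domain g := by
  rw [← one_mul (l2Norm M.domain f * _)]
  refine le_mul_of_forall_weighted zero_le_one (l2Norm_nonneg _ _) (l2Norm_nonneg _ _)
    fun s hs => ?_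
  rw [l2Norm_sq, l2Norm_sq, one_mul, ← integral_const_mul, ← integral_const_mul, ← integral_add
    (hf.norm_sq.integrableOn_domain.const_mul _) (hg.norm_sq.integrableOn_domain.const_mul _)]
  refine integral_mono (hf.norm_mul_norm hg).integrableOn_domain
    ((hf.norm_sq.integrableOn_domain.const_mul _).add
      (hg.norm_sq.integrableOn_domain.const_mul _)) fun x => ?_
  have h := sq_nonneg (s * ‖f x‖ - ‖g x‖)
  have : s / 2 * ‖f x‖ ^ 2 + 1 / (2 * s) * ‖g x‖ ^ 2 - ‖f x‖ * ‖g x‖ =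
      (s * ‖f x‖ - ‖g x‖) ^ 2 / (2 * s) := by
    field_simp; ring
  have h2 : 0 ≤ (s * ‖f x‖ - ‖g x‖) ^ 2 / (2 * s) := by positivity
  change ‖f x‖ * ‖g x‖ ≤ s / 2 * ‖f x‖ ^ 2 + 1 / (2 * s) * ‖g x‖ ^ 2
  linarith

end PiecewiseCont

/-- Exchanging the two derivatives under the integral gives ‖∇·u‖² = ∫ tr((∇u)²), and tr(A²) is at
most the squared Frobenius norm of A. The pointwise bound would lose a factor √d; the zero boundary
values remove it. -/
theorem l2Norm_div_le_l2Norm_gradTensor (hu : u ∈ M.velocitySpace k) :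
    l2Norm M.domain (div u) ≤ l2Norm M.domain (gradTensor u) := by
  rw [← sq_le_sq₀ (l2Norm_nonneg _ _) (l2Norm_nonneg _ _), l2Norm_sq, l2Norm_sq]
  have hpA := piecewiseCont_fderiv_velocity hu
  have hint : ∀ i j i' j', IntegrableOn (fun x => fderiv ℝ u x (basisVec j) i *
      fderiv ℝ u x (basisVec j') i') M.domain := fun i j i' j' =>
    (hpA.comp (φ := fun A => A (basisVec j) i * A (basisVec j') i')
      (by fun_prop)).integrableOn_domain
  have hcomm : ∀ i j, ∫ x in M.domain, fderiv ℝ u x (basisVec i) i * fderiv ℝ u x (basisVec j) j =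
      ∫ x in M.domain, fderiv ℝ u x (basisVec j) i * fderiv ℝ u x (basisVec i) j := by
    intro i j
    have h := (zeroBdry_ext hu i).integral_lineDeriv_mul_comm (zeroBdry_ext hu j)
      (basisVec i) (basisVec j)
    convert h using 1 <;> refine integral_congr_ae (M.ae_domain_of_forall_interior
      fun e x hx => ?_) <;> simp only [lineDeriv_ext hu _ hx]
  have hsum : ∀ {c : Fin d → Fin d → Sp d → ℝ}, (∀ i j, IntegrableOn (c i j) M.domain) →
      ∫ x in M.domain, ∑ i, ∑ j, c i j x = ∑ i, ∑ j, ∫ x in M.domain, c i j x := fun {c} hc => by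
    rw [integral_finsetSum _ fun i _ => integrable_finsetSum _ fun j _ => hc i j]
    exact Finset.sum_congr rfl fun i _ => integral_finsetSum _ fun j _ => hc i j
  calc ∫ x in M.domain, ‖div u x‖ ^ 2
      = ∫ x in M.domain, ∑ i, ∑ j, fderiv ℝ u x (basisVec i) i * fderiv ℝ u x (basisVec j) j := by
        simp only [Real.norm_eq_abs, sq_abs, div]
        simp only [sq, Finset.sum_mul_sum]
    _ = ∑ i, ∑ j, ∫ x in M.domain,
          fderiv ℝ u x (basisVec i) i * fderiv ℝ u x (basisVec j) j := by
        exact hsum fun i j => hint _ _ _ _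
    _ = ∑ i, ∑ j, ∫ x in M.domain,
          fderiv ℝ u x (basisVec j) i * fderiv ℝ u x (basisVec i) j := by
        exact Finset.sum_congr rfl fun i _ => Finset.sum_congr rfl fun j _ => hcomm i j
    _ = ∫ x in M.domain, ∑ i, ∑ j,
          fderiv ℝ u x (basisVec j) i * fderiv ℝ u x (basisVec i) j := by
        exact (hsum fun i j => hint _ _ _ _).symm
    _ ≤ ∫ x in M.domain, ‖gradTensor u x‖ ^ 2 := by
        refine integral_mono (integrable_finsetSum _ fun i _ => integrable_finsetSum _ fun j _ =>
          hint _ _ _ _) (piecewiseCont_gradTensor hu).norm_sq.integrableOn_domain fun x => ?_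
        set a : Fin d → Fin d → ℝ := fun i j => fderiv ℝ u x (basisVec j) i with ha
        have h1 : ‖gradTensor u x‖ ^ 2 = ∑ i, ∑ j, a i j ^ 2 := by
          rw [EuclideanSpace.norm_sq_eq, Fintype.sum_prod_type]
          simp [gradTensor, ha]
        have h2 : ∑ i, ∑ j, a j i ^ 2 = ∑ i, ∑ j, a i j ^ 2 := Finset.sum_comm
        have h3 : ∑ i, ∑ j, a i j * a j i ≤ ∑ i, ∑ j, (a i j ^ 2 / 2 + a j i ^ 2 / 2) :=
          Finset.sum_le_sum fun i _ => Finset.sum_le_sum fun j _ => by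
            nlinarith [sq_nonneg (a i j - a j i)]
        simp only [Finset.sum_add_distrib, ← Finset.sum_div, h2] at h3
        change ∑ i, ∑ j, a i j * a j i ≤ _
        linarith

end Mesh

/-! ### The energy identity -/

/-- The G-stability identity of BDF2: the first two squares minus the next two telescope in time,
and the last is numerical dissipation. -/
theorem two_inner_bdf2_eq {F : Type*} [NormedAddCommGroup F] [InnerProductSpace ℝ F]
    (a b c : F) :
    2 * inner ℝ ((3 : ℝ) • a - (4 : ℝ) • b + c) a =
      ‖a‖ ^ 2 + ‖(2 : ℝ) • a - b‖ ^ 2 - ‖b‖ ^ 2 - ‖(2 : ℝ) • b - c‖ ^ 2 +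
        ‖a - (2 : ℝ) • b + c‖ ^ 2 := by
  simp only [← real_inner_self_eq_norm_sq, inner_add_left, inner_sub_left, inner_smul_left,
    inner_add_right, inner_sub_right, inner_smul_right, conj_trivial,
    real_inner_comm a b, real_inner_comm a c, real_inner_comm b c]
  ring

section Scheme

variable {d : ℕ} [NeZero d] {M : Mesh d} {k l : ℕ} {ν γ α τ : ℝ} {N : ℕ} {u : ℕ → Sp d → Sp d}
  {p : ℕ → Sp d → ℝ} {ψ : ℕ → ℝ}

theorem IsSolution.extrap_mem (h : IsSolution M k l ν γ α τ N u p ψ) {n : ℕ} (hn : n ≤ N + 1) :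
    extrap u n ∈ M.velocitySpace k := by
  have := Mesh.velocitySpace_combination (h.velocity_mem (n - 1) (by omega))
    (h.velocity_mem (n - 2) (by omega)) 2 (-1)
  rwa [neg_one_smul, ← sub_eq_add_neg] at this

theorem IsSolution.secondDiff_mem (h : IsSolution M k l ν γ α τ N u p ψ) {n : ℕ} (hn : n ≤ N) :
    secondDiff u n ∈ M.velocitySpace k := by
  have := Mesh.velocitySpace_combination (Mesh.velocitySpace_combination
    (h.velocity_mem n (by omega)) (h.velocity_mem (n - 1) (by omega)) 1 (-2))
    (h.velocity_mem (n - 2) (by omega)) 1 1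
  have e : secondDiff u n =
      (1 : ℝ) • ((1 : ℝ) • u n + (-2 : ℝ) • u (n - 1)) + (1 : ℝ) • u (n - 2) := by
    rw [secondDiff]; module
  rwa [e]

theorem IsSolution.l2Inner_bdf2 (h : IsSolution M k l ν γ α τ N u p ψ) (hτ : 0 < τ) {n : ℕ}
    (hn2 : 2 ≤ n) (hn : n ≤ N) :
    4 * τ * l2Inner M.domain (bdf2 τ u n) (u n) =
      l2Norm M.domain (u n) ^ 2 + l2Norm M.domain (extrap u (n + 1)) ^ 2 -
        l2Norm M.domain (u (n - 1)) ^ 2 - l2Norm M.domain (extrap u n) ^ 2 +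
        l2Norm M.domain (secondDiff u n) ^ 2 := by
  have hi : ∀ {w : Sp d → Sp d}, w ∈ M.velocitySpace k →
      IntegrableOn (fun x => ‖w x‖ ^ 2) M.domain := fun hw =>
    (Mesh.piecewiseCont_velocity hw).norm_sq.integrableOn_domain
  have h0 := hi (h.velocity_mem n hn)
  have h1 := hi (h.velocity_mem (n - 1) (by omega))
  have h2 := hi (h.extrap_mem (n := n + 1) (by omega))
  have h3 := hi (h.extrap_mem (n := n) (by omega))
  have h4 := hi (h.secondDiff_mem hn)
  have hsum : ∫ x in M.domain, (‖u n x‖ ^ 2 + ‖extrap u (n + 1) x‖ ^ 2 - ‖u (n - 1) x‖ ^ 2 -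
      ‖extrap u n x‖ ^ 2 + ‖secondDiff u n x‖ ^ 2) = (∫ x in M.domain, ‖u n x‖ ^ 2) +
      (∫ x in M.domain, ‖extrap u (n + 1) x‖ ^ 2) - (∫ x in M.domain, ‖u (n - 1) x‖ ^ 2) -
      (∫ x in M.domain, ‖extrap u n x‖ ^ 2) + ∫ x in M.domain, ‖secondDiff u n x‖ ^ 2 := by
    have a1 := integral_add h0 h2
    have a2 := integral_sub (h0.add h2) h1
    have a3 := integral_sub ((h0.add h2).sub h1) h3
    have a4 := integral_add (((h0.add h2).sub h1).sub h3) h4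
    simp only [Pi.add_apply, Pi.sub_apply] at a1 a2 a3 a4
    rw [a4, a3, a2, a1]
  simp only [l2Norm_sq]
  rw [← hsum, l2Inner, ← integral_const_mul]
  refine integral_congr_ae (.of_forall fun x => ?_)
  have key := two_inner_bdf2_eq (u n x) (u (n - 1) x) (u (n - 2) x)
  have e : bdf2 τ u n x =
      (2 * τ)⁻¹ • ((3 : ℝ) • u n x - (4 : ℝ) • u (n - 1) x + u (n - 2) x) := rfl
  simp only [e, inner_smul_left, conj_trivial]
  rw [show 4 * τ * ((2 * τ)⁻¹ * inner ℝ ((3 : ℝ) • u n x - (4 : ℝ) • u (n - 1) x + u (n - 2) x)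
    (u n x)) = 2 * inner ℝ ((3 : ℝ) • u n x - (4 : ℝ) • u (n - 1) x + u (n - 2) x) (u n x) by
      field_simp; norm_num, key]
  rfl

/-- The energy balance of one time step. -/
theorem IsSolution.energy_step (h : IsSolution M k l ν γ α τ N u p ψ) (hα : 0 < α) (hτ : 0 < τ)
    {n : ℕ} (hn2 : 2 ≤ n) (hn : n ≤ N) :
    energy M α u ψ n + ((secondDiff ψ n / √α) ^ 2 + l2Norm M.domain (secondDiff u n) ^ 2 +
      4 * τ * ν * l2Norm M.domain (gradTensor (u n)) ^ 2 +
      4 * γ * τ * ν * l2Norm M.domain (div (u n)) ^ 2) = energy M α u ψ (n - 1) := by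
  have hmom := h.momentum n hn2 hn (u n) (h.velocity_mem n hn)
  have hsav := h.sav n hn2 hn
  have hb := h.l2Inner_bdf2 hτ hn2 hn
  have hψ : 4 * τ * (bdf2 τ ψ n * ψ n) = ψ n ^ 2 + extrap ψ (n + 1) ^ 2 - ψ (n - 1) ^ 2 -
      extrap ψ n ^ 2 + secondDiff ψ n ^ 2 := by
    simp only [bdf2, extrap, secondDiff, smul_eq_mul, Nat.add_sub_cancel,
      show n + 1 - 2 = n - 1 by omega]
    field_simp
    ring
  rw [Mesh.l2Inner_conv_self (h.extrap_mem (by omega)) (h.velocity_mem n hn), l2Inner_self,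
    l2Inner_self] at hmom
  simp only [energy, div_pow, Real.sq_sqrt hα.le]
  rw [show n - 1 + 1 = n by omega]
  set I := l2Inner M.domain (extrap p n) (div (u n))
  rw [hsav] at hψ
  have hψ' : -(4 * τ * (ψ n * I)) = (ψ n ^ 2 + extrap ψ (n + 1) ^ 2 - ψ (n - 1) ^ 2 -
      extrap ψ n ^ 2 + secondDiff ψ n ^ 2) / α := by
    rw [← hψ]; field_simp
  -- The scalar equation times `ψ n` carries exactly the pressure term on the right of the momentum
  -- equation, so the pressure drops out here.
  rw [← hmom] at hψ'
  rw [add_div, sub_div, sub_div, add_div] at hψ'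
  linear_combination -hψ' - hb

theorem IsSolution.energy_identity (h : IsSolution M k l ν γ α τ N u p ψ) (hα : 0 < α)
    (hτ : 0 < τ) (hN : 1 ≤ N) :
    energy M α u ψ N + ∑ n ∈ Finset.Icc 2 N,
      ((secondDiff ψ n / √α) ^ 2 + l2Norm M.domain (secondDiff u n) ^ 2 +
        4 * τ * ν * l2Norm M.domain (gradTensor (u n)) ^ 2 +
        4 * γ * τ * ν * l2Norm M.domain (div (u n)) ^ 2) = energy M α u ψ 1 := by
  have key : ∀ m, 1 ≤ m → m ≤ N → energy M α u ψ m + ∑ n ∈ Finset.Icc 2 m,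
      ((secondDiff ψ n / √α) ^ 2 + l2Norm M.domain (secondDiff u n) ^ 2 +
        4 * τ * ν * l2Norm M.domain (gradTensor (u n)) ^ 2 +
        4 * γ * τ * ν * l2Norm M.domain (div (u n)) ^ 2) = energy M α u ψ 1 := by
    intro m hm
    induction m, hm using Nat.le_induction with
    | base => simp
    | succ m hm ih =>
      intro hmN
      rw [Finset.sum_Icc_succ_top (by omega), ← ih (by omega)]
      have := h.energy_step hα hτ (n := m + 1) (by omega) hmN
      rw [Nat.add_sub_cancel] at this
      rw [← this]
      ring
  exact key N hN le_rfl

end Scheme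

/-! ### The curl on boundary faces -/

/-- Lagrange's identity: the defect is the square of the inner product, which is the hint given to
`nlinarith`. -/
theorem sum_cross_sq_le {d : ℕ} (hd : d = 2 ∨ d = 3) (a b : Sp d) :
    ∑ ij, cross a b ij ^ 2 ≤ ‖a‖ ^ 2 * ‖b‖ ^ 2 := by
  rcases hd with rfl | rfl
  · have h : (Finset.univ : Finset (CrossIdx 2)) = {⟨(0, 1), by decide⟩} := by decide
    simp only [h, Finset.sum_singleton, cross, EuclideanSpace.real_norm_sq_eq, Fin.sum_univ_two]
    nlinarith [sq_nonneg (a 0 * b 0 + a 1 * b 1)]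
  · have h : (Finset.univ : Finset (CrossIdx 3)) =
        {⟨(0, 1), by decide⟩, ⟨(0, 2), by decide⟩, ⟨(1, 2), by decide⟩} := by decide
    simp only [h, cross, EuclideanSpace.real_norm_sq_eq, Fin.sum_univ_three]
    rw [Finset.sum_insert (by decide), Finset.sum_insert (by decide), Finset.sum_singleton]
    nlinarith [sq_nonneg (a 0 * b 0 + a 1 * b 1 + a 2 * b 2)]

/-- The Frobenius norm of a linear map. -/
noncomputable def frob {d : ℕ} (A : Sp d →L[ℝ] Sp d) : ℝ := √(∑ i, ∑ j, (A (basisVec j)) i ^ 2)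

theorem frob_sq {d : ℕ} (A : Sp d →L[ℝ] Sp d) : frob A ^ 2 = ∑ i, ∑ j, (A (basisVec j)) i ^ 2 :=
  Real.sq_sqrt (Finset.sum_nonneg fun _ _ => Finset.sum_nonneg fun _ _ => sq_nonneg _)

theorem frob_nonneg {d : ℕ} (A : Sp d →L[ℝ] Sp d) : 0 ≤ frob A := Real.sqrt_nonneg _

theorem norm_gradTensor {d : ℕ} (u : Sp d → Sp d) (x : Sp d) :
    ‖gradTensor u x‖ = frob (fderiv ℝ u x) := by
  rw [EuclideanSpace.norm_eq, Fintype.sum_prod_type, frob]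
  simp [gradTensor]

theorem apply_eq_sum_basisVec {d : ℕ} (A : Sp d →L[ℝ] Sp d) (v : Sp d) (i : Fin d) :
    A v i = ∑ j, A (basisVec j) i * v j := by
  have hv : v = ∑ j, v j • basisVec j := by
    ext i; simp [basisVec, Finset.sum_apply, Pi.single_apply]
  conv_lhs => rw [hv]
  simp [map_sum, mul_comm]

theorem norm_apply_le_frob {d : ℕ} (A : Sp d →L[ℝ] Sp d) (v : Sp d) : ‖A v‖ ≤ frob A * ‖v‖ := by
  rw [← sq_le_sq₀ (norm_nonneg _) (mul_nonneg (frob_nonneg A) (norm_nonneg _)), mul_pow, frob_sq,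
    EuclideanSpace.real_norm_sq_eq, EuclideanSpace.real_norm_sq_eq, Finset.sum_mul]
  refine Finset.sum_le_sum fun i _ => ?_
  rw [apply_eq_sum_basisVec]
  exact Finset.sum_mul_sq_le_sq_mul_sq _ _ _

/-- A map that kills the complement of `n` has rank at most one: A w = (n · w) A n. Its curl is n ×
A n and its Frobenius norm is |A n|, so the curl costs no factor √2; Cauchy–Schwarz finishes. -/
theorem abs_curlDotCross_le {d : ℕ} (hd : d = 2 ∨ d = 3) (A : Sp d →L[ℝ] Sp d) {n : Sp d}
    (hn : ‖n‖ = 1) (hA : ∀ w, inner ℝ n w = 0 → A w = 0) (b : Sp d) :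
    |curlDotCross A n b| ≤ frob A * ‖b‖ := by
  have hAw : ∀ w, A w = (inner ℝ n w : ℝ) • A n := by
    intro w
    have := hA (w - (inner ℝ n w : ℝ) • n) (by
      rw [inner_sub_right, inner_smul_right, real_inner_self_eq_norm_sq, hn]; ring)
    rw [map_sub, map_smul, sub_eq_zero] at this
    exact this
  have hAj : ∀ i j, A (basisVec j) i = n j * A n i := by
    intro i j
    rw [hAw (basisVec j)]
    simp [basisVec, EuclideanSpace.inner_single_right]
  have hfrob : frob A ^ 2 = ‖A n‖ ^ 2 := by
    have h1 : ∑ j, n j ^ 2 = 1 := by rw [← EuclideanSpace.real_norm_sq_eq, hn, one_pow]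
    rw [frob_sq, EuclideanSpace.real_norm_sq_eq]
    refine Finset.sum_congr rfl fun i _ => ?_
    simp only [hAj, mul_pow]
    rw [← Finset.sum_mul, h1, one_mul]
  have hcurl : ∀ ij, curlOf A ij = cross n (A n) ij := fun ij => by
    rw [curlOf, cross, hAj, hAj]
  refine abs_le_of_sq_le_sq ?_ (mul_nonneg (frob_nonneg A) (norm_nonneg b))
  rw [mul_pow, hfrob, curlDotCross]
  simp only [hcurl]
  refine (Finset.sum_mul_sq_le_sq_mul_sq _ _ _).trans ?_
  have h1 := sum_cross_sq_le hd n (A n)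
  have h2 := sum_cross_sq_le hd n b
  rw [hn, one_pow, one_mul] at h1 h2
  exact mul_le_mul h1 h2 (Finset.sum_nonneg fun _ _ => sq_nonneg _) (sq_nonneg _)

namespace Mesh

variable {d : ℕ} [NeZero d] {M : Mesh d} {k l : ℕ} {u w : Sp d → Sp d}

theorem norm_normal (e : Fin M.numElems) (i : Fin (d + 1)) : ‖M.normal e i‖ = 1 := by
  have h := (M.elem e).height_pos i
  rw [normal, norm_smul, norm_inv, Real.norm_of_nonneg h.le, ← dist_eq_norm, dist_comm]
  exact inv_mul_cancel₀ h.ne'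

/-- The face directions are contained in the orthogonal complement of the normal, and both spaces
have dimension `d - 1`. -/
theorem mem_vectorSpan_face_of_inner_normal_eq_zero (e : Fin M.numElems) (i : Fin (d + 1))
    {w : Sp d} (hw : inner ℝ (M.normal e i) w = 0) :
    w ∈ vectorSpan ℝ ((M.elem e).points '' {i}ᶜ) := by
  set S := M.elem e
  have hmem : M.normal e i ∈ (vectorSpan ℝ (S.points '' {i}ᶜ))ᗮ := by
    have h1 : S.altitudeFoot i -ᵥ S.points i ∈ (S.altitude i).direction :=
      AffineSubspace.vsub_mem_direction (S.altitudeFoot_mem_altitude i) (S.mem_altitude i)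
    rw [S.direction_altitude] at h1
    exact Submodule.smul_mem _ _ h1.1
  have hle : vectorSpan ℝ (S.points '' {i}ᶜ) ≤ (ℝ ∙ M.normal e i)ᗮ := by
    rw [Submodule.le_orthogonal_iff_le_orthogonal, Submodule.span_singleton_le_iff_mem]
    exact hmem
  have hne : M.normal e i ≠ 0 := by
    intro h
    have := norm_normal (M := M) e i
    rw [h, norm_zero] at this
    exact zero_ne_one this
  have h1 : Module.finrank ℝ (vectorSpan ℝ (S.points '' {i}ᶜ)) = d - 1 := by
    rw [← S.range_faceOpposite_points]
    exact (S.faceOpposite i).independent.finrank_vectorSpan (Fintype.card_fin _)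
  have h2 : Module.finrank ℝ (ℝ ∙ M.normal e i)ᗮ = d - 1 := by
    have := Submodule.finrank_add_finrank_orthogonal (ℝ ∙ M.normal e i)
    rw [finrank_span_singleton hne, finrank_euclideanSpace_fin] at this
    omega
  rw [Submodule.eq_of_le_of_finrank_eq hle (h1.trans h2.symm)]
  exact Submodule.mem_orthogonal_singleton_iff_inner_right.2 hw

/-- The function is zero along the segment from `x` to `y`. A one-sided derivative at the endpoint
is enough, so `x` may lie on the relative boundary of `s`. -/
theorem fderiv_apply_eq_zero_of_convex {F : Type*} [NormedAddCommGroup F] [NormedSpace ℝ F]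
    {f : Sp d → F} {s : Set (Sp d)} (hs : Convex ℝ s) (hf : ∀ y ∈ s, f y = 0) {x y : Sp d}
    (hx : x ∈ s) (hy : y ∈ s) (hd : DifferentiableAt ℝ f x) : fderiv ℝ f x (y - x) = 0 := by
  have h1 : HasDerivAt (fun t : ℝ => f (x + t • (y - x))) (fderiv ℝ f x (y - x)) 0 := by
    have hd' : HasFDerivAt f (fderiv ℝ f x) (x + (0 : ℝ) • (y - x)) := by
      simpa using hd.hasFDerivAt
    have hc : HasDerivAt (fun t : ℝ => x + t • (y - x)) (y - x) 0 := by
      simpa using ((hasDerivAt_id (0 : ℝ)).smul_const (y - x)).const_add x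
    exact hd'.comp_hasDerivAt 0 hc
  have h2 : HasDerivWithinAt (fun t : ℝ => f (x + t • (y - x))) 0 (Set.Icc 0 1) 0 := by
    refine (hasDerivWithinAt_const (0 : ℝ) (Set.Icc 0 1) (0 : F)).congr_of_mem (fun t ht => ?_)
      ⟨le_rfl, zero_le_one⟩
    exact hf _ (hs.add_smul_sub_mem hx hy ht)
  exact (uniqueDiffOn_Icc zero_lt_one 0 ⟨le_rfl, zero_le_one⟩).eq_deriv _ h1.hasDerivWithinAt h2

theorem fderivWithin_cell {F : Type*} [NormedAddCommGroup F] [NormedSpace ℝ F] {f g : Sp d → F}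
    {e : Fin M.numElems} (h : Set.EqOn f g (M.cell e)) (hg : Differentiable ℝ g) {x : Sp d}
    (hx : x ∈ M.cell e) : fderivWithin ℝ f (M.cell e) x = fderiv ℝ g x := by
  rw [fderivWithin_congr h (h hx)]
  exact (hg x).fderivWithin (uniqueDiffWithinAt_convex (M.convex_cell e)
    (M.interior_cell_nonempty e) (subset_closure hx))

/-- On a face in Γ the velocity is zero, so its derivative kills all tangential directions; these
are all the directions orthogonal to the normal, as the rank-one bound requires. -/
theorem abs_curlDotCross_face_le (hd : d = 2 ∨ d = 3) (hu : u ∈ M.velocitySpace k)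
    {e : Fin M.numElems} {i : Fin (d + 1)} (hi : M.face e i ⊆ M.bdry) {x : Sp d}
    (hx : x ∈ M.face e i) (b : Sp d) :
    |curlDotCross (fderivWithin ℝ u (M.cell e) x) (M.normal e i) b| ≤
      frob (fderivWithin ℝ u (M.cell e) x) * ‖b‖ := by
  obtain ⟨P, -, hP⟩ := exists_polyVec hu e
  have hdiff := (contDiff_polyVec P).differentiable one_ne_zero
  rw [fderivWithin_cell hP hdiff (M.face_subset_cell e i hx)]
  refine abs_curlDotCross_le hd _ (norm_normal e i) (fun w hw => ?_) b
  have hzero : ∀ y ∈ M.face e i, polyVec P y = 0 := fun y hy => by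
    rw [← hP (M.face_subset_cell e i hy), hu.2 y (hi hy)]
  have hker : vectorSpan ℝ ((M.elem e).points '' {i}ᶜ) ≤
      LinearMap.ker (fderiv ℝ (polyVec P) x : Sp d →ₗ[ℝ] Sp d) := by
    rw [vectorSpan_def, Submodule.span_le]
    rintro _ ⟨y, hy, z, hz, rfl⟩
    have hy' := fderiv_apply_eq_zero_of_convex (convex_convexHull ℝ _) hzero hx
      (subset_convexHull ℝ _ hy) (hdiff x)
    have hz' := fderiv_apply_eq_zero_of_convex (convex_convexHull ℝ _) hzero hx
      (subset_convexHull ℝ _ hz) (hdiff x)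
    have : y -ᵥ z = (y - x) - (z - x) := by rw [vsub_eq_sub]; abel
    simp only [SetLike.mem_coe, LinearMap.mem_ker, ContinuousLinearMap.coe_coe]
    rw [this, map_sub, hy', hz', sub_zero]
  exact hker (mem_vectorSpan_face_of_inner_normal_eq_zero e i hw)

/-! ### Boundary integrals -/

theorem abs_bdryIntegral_le (e : Fin M.numElems) {f : Fin (d + 1) → Sp d → ℝ} {g : Sp d → ℝ}
    (hg : Continuous g)
    (h : ∀ i, M.face e i ⊆ M.bdry → ∀ x ∈ M.face e i, |f i x| ≤ g x) :
    |M.bdryIntegral e f| ≤ M.bdryIntegral e fun _ => g := by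
  refine (Finset.abs_sum_le_sum_abs _ _).trans (Finset.sum_le_sum fun i _ => ?_)
  split_ifs with hi
  · rw [← Real.norm_eq_abs]
    exact norm_integral_le_of_norm_le (M.integrableOn_face e i hg)
      ((ae_restrict_iff' (M.isCompact_face e i).measurableSet).2
        (.of_forall fun x hx => (Real.norm_eq_abs _).trans_le (h i hi x hx)))
  · simp

theorem bdryIntegral_add (e : Fin M.numElems) {f g : Sp d → ℝ} (hf : Continuous f)
    (hg : Continuous g) : (M.bdryIntegral e fun _ x => f x + g x) =
      (M.bdryIntegral e fun _ => f) + M.bdryIntegral e fun _ => g := by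
  rw [bdryIntegral, bdryIntegral, bdryIntegral, ← Finset.sum_add_distrib]
  refine Finset.sum_congr rfl fun i _ => ?_
  split_ifs
  · exact integral_add (M.integrableOn_face e i hf) (M.integrableOn_face e i hg)
  · simp

theorem bdryIntegral_const_mul (e : Fin M.numElems) (c : ℝ) (f : Sp d → ℝ) :
    (M.bdryIntegral e fun _ x => c * f x) = c * M.bdryIntegral e fun _ => f := by
  rw [bdryIntegral, bdryIntegral, Finset.mul_sum]
  refine Finset.sum_congr rfl fun i _ => ?_
  split_ifs
  · exact integral_const_mul _ _
  · simp

theorem bdryIntegral_sum {ι : Type*} (s : Finset ι) (e : Fin M.numElems) {f : ι → Sp d → ℝ}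
    (hf : ∀ m, Continuous (f m)) : (M.bdryIntegral e fun _ x => ∑ m ∈ s, f m x) =
      ∑ m ∈ s, M.bdryIntegral e fun _ => f m := by
  classical
  induction s using Finset.induction_on with
  | empty => simp [bdryIntegral]
  | insert m s hm ih =>
    simp only [Finset.sum_insert hm]
    rw [bdryIntegral_add e (hf m) (continuous_finsetSum _ fun m _ => hf m), ih]

theorem bdryIntegral_sq_nonneg (e : Fin M.numElems) (f : Sp d → ℝ) :
    0 ≤ M.bdryIntegral e fun _ x => f x ^ 2 := by
  refine Finset.sum_nonneg fun i _ => ?_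
  split_ifs
  · exact integral_nonneg fun _ => sq_nonneg _
  · exact le_rfl

theorem IsTraceConstant.bdryIntegral_sq_le {r : ℕ} {Ctr : ℝ} (h : M.IsTraceConstant r Ctr)
    (e : Fin M.numElems) {P : MvPolynomial (Fin d) ℝ} (hP : P.totalDegree ≤ r) :
    M.elemSize e * (M.bdryIntegral e fun _ x => polyFun P x ^ 2) ≤
      Ctr ^ 2 * ∫ x in M.cell e, polyFun P x ^ 2 := by
  have h1 := (h e P hP).2
  have h2 := pow_le_pow_left₀ (mul_nonneg (Real.sqrt_nonneg _) (Real.sqrt_nonneg _)) h1 2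
  rw [mul_pow, mul_pow, Real.sq_sqrt (M.elemSize_pos e).le,
    Real.sq_sqrt (bdryIntegral_sq_nonneg e fun x => P.eval fun j => x j),
    Real.sq_sqrt (integral_nonneg fun _ => sq_nonneg _)] at h2
  exact h2

/-- In squared form the scalar trace inequality adds over components, so gradients inherit the same
constant. -/
theorem IsTraceConstant.bdryIntegral_sum_sq_le {r : ℕ} {Ctr : ℝ} (h : M.IsTraceConstant r Ctr)
    (e : Fin M.numElems) {ι : Type*} (s : Finset ι) {P : ι → MvPolynomial (Fin d) ℝ}
    (hP : ∀ m, (P m).totalDegree ≤ r) :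
    M.elemSize e * (M.bdryIntegral e fun _ x => ∑ m ∈ s, polyFun (P m) x ^ 2) ≤
      Ctr ^ 2 * ∫ x in M.cell e, ∑ m ∈ s, polyFun (P m) x ^ 2 := by
  rw [bdryIntegral_sum s e (f := fun m x => polyFun (P m) x ^ 2)
    fun m => (continuous_polyFun (P m)).pow 2, integral_finsetSum
    (f := fun m x => polyFun (P m) x ^ 2) _
    fun m _ => ((continuous_polyFun (P m)).pow 2).continuousOn.integrableOn_compact
      (M.isCompact_cell e), Finset.mul_sum, Finset.mul_sum]
  exact Finset.sum_le_sum fun m _ => h.bdryIntegral_sq_le e (hP m)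

theorem norm_toDual_symm_sq (B : Sp d →L[ℝ] ℝ) :
    ‖(InnerProductSpace.toDual ℝ (Sp d)).symm B‖ ^ 2 = ∑ j, B (basisVec j) ^ 2 := by
  rw [EuclideanSpace.real_norm_sq_eq]
  refine Finset.sum_congr rfl fun j _ => ?_
  rw [show B (basisVec j) = inner ℝ ((InnerProductSpace.toDual ℝ (Sp d)).symm B) (basisVec j) from
    InnerProductSpace.toDual_symm_apply.symm, basisVec, EuclideanSpace.inner_single_right]
  simp

/-- The traces of the gradients are polynomials of admissible degree, so the trace inequality
applies to both factors. The weighted form with a free `s` is linear in the squared norms and can be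
summed over elements. -/
theorem elemSize_mul_abs_bdryIntegral_curl_le (hd : d = 2 ∨ d = 3) (hu : u ∈ M.velocitySpace k)
    {p : Sp d → ℝ} (hp : p ∈ M.lagrange l) {Ctr : ℝ} (hC : M.IsTraceConstant (max k l) Ctr)
    (e : Fin M.numElems) {s : ℝ} (hs : 0 < s) :
    M.elemSize e * |M.bdryIntegral e fun i x => curlDotCross (fderivWithin ℝ u (M.cell e) x)
        (M.normal e i) (gradientWithin p (M.cell e) x)| ≤
      Ctr ^ 2 * (s / 2 * (∫ x in interior (M.cell e), ‖gradTensor u x‖ ^ 2) +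
        1 / (2 * s) * ∫ x in interior (M.cell e), ‖gradient p x‖ ^ 2) := by
  obtain ⟨P, hPdeg, hP⟩ := exists_polyVec hu e
  obtain ⟨R, hRdeg, hR⟩ := hp.2 e
  have hR' : Set.EqOn p (polyFun R) (M.cell e) := hR
  have hPd := (contDiff_polyVec P).differentiable one_ne_zero
  have hRd := (contDiff_polyFun R).differentiable one_ne_zero
  set a : Sp d → ℝ := fun x => ∑ m : Fin d × Fin d,
    polyFun (MvPolynomial.pderiv m.2 (P m.1)) x ^ 2 with ha
  set b : Sp d → ℝ := fun x => ∑ j, polyFun (MvPolynomial.pderiv j R) x ^ 2 with hb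
  have hac : Continuous a := continuous_finsetSum _ fun m _ => (continuous_polyFun _).pow 2
  have hbc : Continuous b := continuous_finsetSum _ fun m _ => (continuous_polyFun _).pow 2
  have hfa : ∀ x, frob (fderiv ℝ (polyVec P) x) ^ 2 = a x := fun x => by
    rw [frob_sq, ha]
    simp only [Fintype.sum_prod_type, fderiv_polyVec_apply, fderiv_polyFun_basisVec]
  have hgb : ∀ x, ‖(InnerProductSpace.toDual ℝ (Sp d)).symm (fderiv ℝ (polyFun R) x)‖ ^ 2 = b x :=
    fun x => by
      rw [norm_toDual_symm_sq, hb]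
      simp only [fderiv_polyFun_basisVec]
  have hint1 : ∫ x in interior (M.cell e), ‖gradTensor u x‖ ^ 2 = ∫ x in M.cell e, a x := by
    rw [← integral_interior_cell]
    refine setIntegral_congr_fun isOpen_interior.measurableSet fun x hx => ?_
    simp only [norm_gradTensor]
    rw [(eventuallyEq_of_mem_interior hP hx).fderiv_eq, hfa]
  have hint2 : ∫ x in interior (M.cell e), ‖gradient p x‖ ^ 2 = ∫ x in M.cell e, b x := by
    rw [← integral_interior_cell]
    refine setIntegral_congr_fun isOpen_interior.measurableSet fun x hx => ?_
    simp only [gradient]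
    rw [(eventuallyEq_of_mem_interior hR' hx).fderiv_eq, hgb]
  have hpt : ∀ i, M.face e i ⊆ M.bdry → ∀ x ∈ M.face e i,
      |curlDotCross (fderivWithin ℝ u (M.cell e) x) (M.normal e i)
        (gradientWithin p (M.cell e) x)| ≤ s / 2 * a x + 1 / (2 * s) * b x := by
    intro i hi x hx
    refine (abs_curlDotCross_face_le hd hu hi hx _).trans ?_
    have hxc := M.face_subset_cell e i hx
    rw [gradientWithin, fderivWithin_cell hP hPd hxc, fderivWithin_cell hR' hRd hxc, ← hfa x,
      ← hgb x]
    set α := frob (fderiv ℝ (polyVec P) x)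
    set β := ‖(InnerProductSpace.toDual ℝ (Sp d)).symm (fderiv ℝ (polyFun R) x)‖
    have : s / 2 * α ^ 2 + 1 / (2 * s) * β ^ 2 - α * β = (s * α - β) ^ 2 / (2 * s) := by
      field_simp; ring
    have h2 : 0 ≤ (s * α - β) ^ 2 / (2 * s) := by positivity
    linarith
  have h1 := abs_bdryIntegral_le e (g := fun x => s / 2 * a x + 1 / (2 * s) * b x)
    ((hac.const_mul (s / 2)).add (hbc.const_mul (1 / (2 * s)))) hpt
  rw [bdryIntegral_add e (hac.const_mul _) (hbc.const_mul _), bdryIntegral_const_mul,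
    bdryIntegral_const_mul] at h1
  have h2 := hC.bdryIntegral_sum_sq_le e Finset.univ
    (P := fun m : Fin d × Fin d => MvPolynomial.pderiv m.2 (P m.1))
    fun m => (totalDegree_pderiv_le _ _).trans ((hPdeg _).trans (le_max_left _ _))
  have h3 := hC.bdryIntegral_sum_sq_le e Finset.univ (P := fun j => MvPolynomial.pderiv j R)
    fun j => (totalDegree_pderiv_le _ _).trans (hRdeg.trans (le_max_right _ _))
  rw [hint1, hint2]
  have h4 := mul_le_mul_of_nonneg_left h1 (M.elemSize_pos e).le
  have h5 := mul_le_mul_of_nonneg_left h2 (show 0 ≤ s / 2 by positivity)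
  have h6 := mul_le_mul_of_nonneg_left h3 (show 0 ≤ 1 / (2 * s) by positivity)
  change s / 2 * (M.elemSize e * M.bdryIntegral e fun _ => a) ≤
    s / 2 * (Ctr ^ 2 * ∫ x in M.cell e, a x) at h5
  change 1 / (2 * s) * (M.elemSize e * M.bdryIntegral e fun _ => b) ≤
    1 / (2 * s) * (Ctr ^ 2 * ∫ x in M.cell e, b x) at h6
  linarith

/-- Quasi-uniformity replaces 1 / h_e by Q / h. The weight `s` is common to all elements and
optimised only after summation, which yields the product of the global norms. -/
theorem abs_curlBdry_le (hd : d = 2 ∨ d = 3) (hu : u ∈ M.velocitySpace k)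
    {p : Sp d → ℝ} (hp : p ∈ M.lagrange l) {Ctr Q : ℝ} (hC : M.IsTraceConstant (max k l) Ctr)
    (hQ : M.QuasiUniform Q) :
    |M.curlBdry u p| ≤ Ctr ^ 2 * Q / M.size *
      (l2Norm M.domain (gradTensor u) * l2Norm M.domain (gradient p)) := by
  have hh := M.size_pos
  have hQ0 : 0 ≤ Q := zero_le_one.trans hQ.1
  refine le_mul_of_forall_weighted (by positivity) (l2Norm_nonneg _ _) (l2Norm_nonneg _ _)
    fun s hs => ?_
  rw [l2Norm_sq, l2Norm_sq, integral_domain_eq_sum (piecewiseCont_gradTensor hu).norm_sq,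
    integral_domain_eq_sum (piecewiseCont_gradient hp).norm_sq, Finset.mul_sum, Finset.mul_sum,
    ← Finset.sum_add_distrib, Finset.mul_sum]
  refine (Finset.abs_sum_le_sum_abs _ _).trans (Finset.sum_le_sum fun e _ => ?_)
  have h1 := elemSize_mul_abs_bdryIntegral_curl_le hd hu hp hC e hs
  have he := M.elemSize_pos e
  set X := |M.bdryIntegral e fun i x => curlDotCross (fderivWithin ℝ u (M.cell e) x)
        (M.normal e i) (gradientWithin p (M.cell e) x)|
  set Y := s / 2 * (∫ x in interior (M.cell e), ‖gradTensor u x‖ ^ 2) +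
        1 / (2 * s) * ∫ x in interior (M.cell e), ‖gradient p x‖ ^ 2
  have hY : 0 ≤ Y := by
    have i1 : 0 ≤ ∫ x in interior (M.cell e), ‖gradTensor u x‖ ^ 2 :=
      integral_nonneg fun _ => sq_nonneg _
    have i2 : 0 ≤ ∫ x in interior (M.cell e), ‖gradient p x‖ ^ 2 :=
      integral_nonneg fun _ => sq_nonneg _
    positivity
  have hq := hQ.2 e
  rw [div_le_iff₀ he] at hq
  have h2 : M.size * X ≤ Q * (M.elemSize e * X) := by
    rw [← mul_assoc]
    exact mul_le_mul_of_nonneg_right hq (abs_nonneg _)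
  have h3 : M.size * X ≤ Q * (Ctr ^ 2 * Y) := h2.trans (mul_le_mul_of_nonneg_left h1 hQ0)
  rw [div_mul_eq_mul_div, le_div_iff₀ hh]
  linarith

/-! ### The convective term -/

theorem ae_norm_le_supNorm (hu : u ∈ M.velocitySpace k) :
    ∀ᵐ x ∂volume.restrict M.domain, ‖u x‖ ≤ supNorm M.domain u := by
  have hcont : ContinuousOn u (closure M.domain) := by
    have h : ContinuousOn (fun x => (WithLp.toLp 2 fun i => u x i : Sp d)) (closure M.domain) :=
      (PiLp.continuous_toLp 2 _).comp_continuousOn (continuousOn_pi.2 fun i => (hu.1 i).1)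
    exact h
  obtain ⟨C, hC⟩ := M.isCompact_closure_domain.exists_bound_of_continuousOn hcont
  have hmem : MemLp u ⊤ (volume.restrict M.domain) :=
    memLp_top_of_bound (piecewiseCont_velocity hu).integrableOn_domain.aestronglyMeasurable C
      ((ae_restrict_iff' M.isOpen_domain.measurableSet).2
        (.of_forall fun x hx => hC x (subset_closure hx)))
  -- Finiteness matters: `toReal` would send an infinite supremum to 0 and the bound would fail.
  have hne : eLpNorm u ⊤ (volume.restrict M.domain) ≠ ⊤ := hmem.eLpNorm_ne_top
  filter_upwards [ae_le_eLpNormEssSup (f := u) (μ := volume.restrict M.domain)] with x hx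
  rw [supNorm, ← toReal_enorm]
  refine ENNReal.toReal_mono hne ?_
  rwa [eLpNorm_exponent_top]

/-- The factor 3/2 is 1 from the convective derivative plus 1/2 from the divergence term, the latter
through ‖∇·u‖ ≤ ‖∇u‖. -/
theorem abs_l2Inner_conv_le (hu : u ∈ M.velocitySpace k) {p : Sp d → ℝ}
    (hp : p ∈ M.lagrange l) :
    |l2Inner M.domain (fun x => -conv u u x - (div u x / 2) • u x) (gradient p)| ≤
      3 / 2 * supNorm M.domain u *
        (l2Norm M.domain (gradTensor u) * l2Norm M.domain (gradient p)) := by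
  have hg := piecewiseCont_gradient hp
  have hA := (piecewiseCont_gradTensor hu).norm_mul_norm hg
  have hD := (piecewiseCont_div hu).norm_mul_norm hg
  set U := supNorm M.domain u
  have hU : 0 ≤ U := ENNReal.toReal_nonneg
  have h1 : |l2Inner M.domain (fun x => -conv u u x - (div u x / 2) • u x) (gradient p)| ≤
      ∫ x in M.domain, (U * (‖gradTensor u x‖ * ‖gradient p x‖) +
        U / 2 * (‖div u x‖ * ‖gradient p x‖)) := by
    rw [l2Inner, ← Real.norm_eq_abs]
    refine norm_integral_le_of_norm_le ((hA.integrableOn_domain.const_mul U).add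
      (hD.integrableOn_domain.const_mul (U / 2))) ?_
    filter_upwards [ae_norm_le_supNorm hu] with x hx
    refine (norm_inner_le_norm _ _).trans ?_
    have h2 : ‖-conv u u x - (div u x / 2) • u x‖ ≤ ‖gradTensor u x‖ * U + ‖div u x‖ / 2 * U := by
      refine (norm_sub_le _ _).trans ?_
      rw [norm_neg, norm_smul, norm_div, Real.norm_of_nonneg (zero_le_two : (0 : ℝ) ≤ 2),
        norm_gradTensor]
      refine add_le_add ((norm_apply_le_frob _ _).trans ?_) ?_
      · exact mul_le_mul_of_nonneg_left hx (frob_nonneg _)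
      · exact mul_le_mul_of_nonneg_left hx (by positivity)
    refine (mul_le_mul_of_nonneg_right h2 (norm_nonneg _)).trans (le_of_eq ?_)
    ring
  rw [integral_add (hA.integrableOn_domain.const_mul U) (hD.integrableOn_domain.const_mul (U / 2)),
    integral_const_mul, integral_const_mul] at h1
  have h2 := (piecewiseCont_gradTensor hu).integral_norm_mul_norm_le hg
  have h3 := (piecewiseCont_div hu).integral_norm_mul_norm_le hg
  have h4 := mul_le_mul_of_nonneg_right (l2Norm_div_le_l2Norm_gradTensor hu)
    (l2Norm_nonneg M.domain (gradient p))
  have h5 := mul_le_mul_of_nonneg_left h2 hU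
  have h6 := mul_le_mul_of_nonneg_left (h3.trans h4) (div_nonneg hU zero_le_two)
  linarith

/-- The pressure gradient is controlled by the velocity gradient. -/
theorem _root_.SplittingSAV.IsSolution.pressure_bound {ν γ α τ : ℝ} {N : ℕ} {u : ℕ → Sp d → Sp d}
    {p : ℕ → Sp d → ℝ} {ψ : ℕ → ℝ} (hd : d = 2 ∨ d = 3) (h : IsSolution M k l ν γ α τ N u p ψ)
    {Ctr Q : ℝ} (hC : M.IsTraceConstant (max k l) Ctr) (hQ : M.QuasiUniform Q) (hν : 0 < ν) {n : ℕ}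
    (hn2 : 2 ≤ n) (hn : n ≤ N) :
    8 / 7 * beta M ν ((Ctr ^ 2 * Q) ^ 2) u n * ψ n ^ 2 * l2Norm M.domain (gradient (p n)) ^ 2 ≤
      4 * ν * l2Norm M.domain (gradTensor (u n)) ^ 2 := by
  have hu := h.velocity_mem n hn
  have hp := h.pressure_mem n hn
  have hppe := h.ppe n hn2 hn (p n) hp
  have h1 := abs_l2Inner_conv_le hu hp
  have h2 := abs_curlBdry_le hd hu hp hC hQ
  have hh := M.size_pos
  have hQ0 : 0 ≤ Q := zero_le_one.trans hQ.1
  have hG := l2Norm_nonneg M.domain (gradTensor (u n))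
  have hP := l2Norm_nonneg M.domain (gradient (p n))
  have hU : 0 ≤ supNorm M.domain (u n) := ENNReal.toReal_nonneg
  rw [l2Inner_self] at hppe
  rw [beta]
  set U := supNorm M.domain (u n)
  set G := l2Norm M.domain (gradTensor (u n))
  set P := l2Norm M.domain (gradient (p n))
  set κ := ν * (Ctr ^ 2 * Q / M.size) with hκ
  have hκ0 : 0 ≤ κ := by positivity
  -- This explains C = (C_tr² Q)²: `κ` is the coefficient of the boundary term, and the reciprocal
  -- weight becomes (U² + κ²) / ν.
  have hden : 1 / ν * U ^ 2 + (Ctr ^ 2 * Q) ^ 2 * ν / M.size ^ 2 = (U ^ 2 + κ ^ 2) / ν := by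
    rw [hκ]; field_simp
  have habs : |ψ n| * P ^ 2 ≤ (3 / 2 * U + κ) * (G * P) := by
    have e : |ψ n| * P ^ 2 = |ψ n * P ^ 2| := by rw [abs_mul, abs_of_nonneg (sq_nonneg P)]
    rw [e, hppe]
    refine (abs_add_le _ _).trans ?_
    rw [abs_mul, abs_of_pos hν]
    have := mul_le_mul_of_nonneg_left h2 hν.le
    rw [← mul_assoc ν, ← hκ] at this
    linarith
  have hlin : |ψ n| * P ≤ (3 / 2 * U + κ) * G := by
    rcases hP.eq_or_lt with h0 | h0
    · rw [← h0, mul_zero]; positivity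
    · refine le_of_mul_le_mul_right ?_ h0
      linarith
  -- Here 13/4 = (3/2)² + 1² by Cauchy–Schwarz. Multiplied by 8/7 it gives 26/7, below the available
  -- 4.
  have hsq : ψ n ^ 2 * P ^ 2 ≤ 13 / 4 * (U ^ 2 + κ ^ 2) * G ^ 2 := by
    have h3 := pow_le_pow_left₀ (mul_nonneg (abs_nonneg _) hP) hlin 2
    rw [mul_pow, sq_abs, mul_pow] at h3
    refine h3.trans (mul_le_mul_of_nonneg_right ?_ (sq_nonneg G))
    nlinarith [sq_nonneg (U - 3 / 2 * κ)]
  rw [hden, inv_div]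
  have hG2 : 0 ≤ ν * G ^ 2 := by positivity
  -- If `U` and `κ` both vanish, the weight is a division by zero with value 0, and the claim is
  -- trivial.
  rcases (show 0 ≤ U ^ 2 + κ ^ 2 by positivity).eq_or_lt with h0 | h0
  · rw [← h0]; simp only [div_zero, mul_zero, zero_mul]; linarith
  · have h4 : ν / (U ^ 2 + κ ^ 2) * (ψ n ^ 2 * P ^ 2) ≤
        ν / (U ^ 2 + κ ^ 2) * (13 / 4 * (U ^ 2 + κ ^ 2) * G ^ 2) :=
      mul_le_mul_of_nonneg_left hsq (by positivity)
    have h5 : ν / (U ^ 2 + κ ^ 2) * (13 / 4 * (U ^ 2 + κ ^ 2) * G ^ 2) = 13 / 4 * (ν * G ^ 2) := by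
      field_simp
    rw [h5] at h4
    linarith

end Mesh

/-! ### Existence of trace constants -/

/-- `Ψ` factors through the range of `Φ`, which is finite-dimensional, so the factor is continuous.
No norm on `V` is needed. -/
theorem exists_norm_le_mul_norm_of_ker_le {V E F : Type*} [AddCommGroup V] [Module ℝ V]
    [Module.Finite ℝ V] [NormedAddCommGroup E] [NormedSpace ℝ E] [NormedAddCommGroup F]
    [NormedSpace ℝ F] (Φ : V →ₗ[ℝ] E) (Ψ : V →ₗ[ℝ] F)
    (h : LinearMap.ker Φ ≤ LinearMap.ker Ψ) : ∃ C, 0 ≤ C ∧ ∀ v, ‖Ψ v‖ ≤ C * ‖Φ v‖ := by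
  obtain ⟨s, hs⟩ := Φ.rangeRestrict.exists_rightInverse_of_surjective Φ.range_rangeRestrict
  set G : LinearMap.range Φ →L[ℝ] F := LinearMap.toContinuousLinearMap (Ψ ∘ₗ s) with hG
  refine ⟨‖G‖, G.opNorm_nonneg, fun v => ?_⟩
  have h1 : Φ (s (Φ.rangeRestrict v)) = Φ v :=
    congrArg Subtype.val (LinearMap.congr_fun hs (Φ.rangeRestrict v))
  have h2 : Ψ (v - s (Φ.rangeRestrict v)) = 0 :=
    h (by rw [LinearMap.mem_ker, map_sub, h1, sub_self])
  rw [map_sub, sub_eq_zero] at h2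
  rw [h2]
  exact G.le_opNorm (Φ.rangeRestrict v)

theorem polyFun_add {d : ℕ} (P R : MvPolynomial (Fin d) ℝ) (x : Sp d) :
    polyFun (P + R) x = polyFun P x + polyFun R x := by simp [polyFun]

theorem polyFun_smul {d : ℕ} (c : ℝ) (P : MvPolynomial (Fin d) ℝ) (x : Sp d) :
    polyFun (c • P) x = c * polyFun P x := by simp [polyFun]

/-- On a convex body, the supremum of a polynomial is controlled by its mean square. -/
theorem exists_polyFun_sq_le_integral {d : ℕ} (r : ℕ) {K : Set (Sp d)} (hK : IsCompact K)
    (hKi : K ⊆ closure (interior K)) : ∃ C, 0 ≤ C ∧ ∀ P : MvPolynomial (Fin d) ℝ,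
      P.totalDegree ≤ r → ∀ x ∈ K, polyFun P x ^ 2 ≤ C * ∫ y in K, polyFun P y ^ 2 := by
  have : CompactSpace K := isCompact_iff_compactSpace.1 hK
  have hmem : ∀ P : MvPolynomial (Fin d) ℝ, MemLp (polyFun P) 2 (volume.restrict K) := fun P => by
    have : IsFiniteMeasure (volume.restrict K) := ⟨by
      rw [Measure.restrict_apply_univ]; exact hK.measure_lt_top⟩
    obtain ⟨C, hC⟩ := hK.exists_bound_of_continuousOn (continuous_polyFun P).continuousOn
    exact MemLp.of_bound (continuous_polyFun P).aestronglyMeasurable C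
      ((ae_restrict_iff' hK.measurableSet).2 (.of_forall hC))
  let V := MvPolynomial.restrictTotalDegree (Fin d) ℝ r
  let Φ : V →ₗ[ℝ] Lp ℝ 2 (volume.restrict K) :=
    { toFun := fun P => (hmem P.1).toLp _
      map_add' := fun P R => by
        rw [← MemLp.toLp_add]
        exact MemLp.toLp_congr _ _ (.of_forall fun x => polyFun_add P.1 R.1 x)
      map_smul' := fun c P => by
        rw [RingHom.id_apply, ← MemLp.toLp_const_smul]
        exact MemLp.toLp_congr _ _ (.of_forall fun x => polyFun_smul c P.1 x) }
  let Ψ : V →ₗ[ℝ] C(K, ℝ) :=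
    { toFun := fun P => ⟨fun x => polyFun P.1 x, (continuous_polyFun P.1).comp
        continuous_subtype_val⟩
      map_add' := fun P R => by ext x; exact polyFun_add P.1 R.1 x
      map_smul' := fun c P => by ext x; exact polyFun_smul c P.1 x }
  -- A polynomial that is zero almost everywhere on `K` vanishes on the interior by continuity,
  -- hence on its closure, which contains `K`.
  have hker : LinearMap.ker Φ ≤ LinearMap.ker Ψ := by
    intro P hP
    rw [LinearMap.mem_ker] at hP ⊢
    have h0 : polyFun P.1 =ᵐ[volume.restrict K] 0 := 
      (hmem P.1).coeFn_toLp.symm.trans ((Lp.eq_zero_iff_ae_eq_zero).1 hP)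
    have h1 : polyFun P.1 =ᵐ[volume.restrict (interior K)] fun _ => 0 :=
      ae_restrict_of_ae_restrict_of_subset interior_subset h0
    have h2 := Measure.eqOn_open_of_ae_eq h1 isOpen_interior (continuous_polyFun _).continuousOn
      continuousOn_const
    have h3 := h2.closure (continuous_polyFun _) continuous_const
    ext x
    exact h3 (hKi x.2)
  obtain ⟨C, hC0, hC⟩ := exists_norm_le_mul_norm_of_ker_le Φ Ψ hker
  refine ⟨C ^ 2, sq_nonneg C, fun P hP x hx => ?_⟩
  let v : V := ⟨P, (MvPolynomial.mem_restrictTotalDegree _ _ _).2 hP⟩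
  have h1 : |polyFun P x| ≤ C * ‖Φ v‖ := ((Ψ v).norm_coe_le_norm ⟨x, hx⟩).trans (hC v)
  have h2 : ‖Φ v‖ ^ 2 = ∫ y in K, polyFun P y ^ 2 := by
    rw [← real_inner_self_eq_norm_sq, L2.inner_def]
    refine integral_congr_ae ?_
    filter_upwards [(hmem P).coeFn_toLp] with y hy
    have hy' : (Φ v) y = polyFun P y := hy
    rw [real_inner_self_eq_norm_sq, hy', Real.norm_eq_abs, sq_abs]
  have h3 := pow_le_pow_left₀ (abs_nonneg _) h1 2
  rwa [sq_abs, mul_pow, h2] at h3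

theorem exists_polyFun_comp_affine {d : ℕ} (T : Sp d →ᵃ[ℝ] Sp d) (P : MvPolynomial (Fin d) ℝ) :
    ∃ R : MvPolynomial (Fin d) ℝ, R.totalDegree ≤ P.totalDegree ∧
      ∀ y, polyFun R y = polyFun P (T y) := by
  let L : Fin d → MvPolynomial (Fin d) ℝ := fun j => MvPolynomial.C (T 0 j) +
    ∑ m, MvPolynomial.C (T.linear (basisVec m) j) * MvPolynomial.X m
  refine ⟨MvPolynomial.aeval L P, totalDegree_aeval_le L (fun j => ?_) P, fun y => ?_⟩
  · refine (MvPolynomial.totalDegree_add _ _).trans (max_le (by simp) ?_)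
    refine MvPolynomial.totalDegree_finsetSum_le fun m _ => ?_
    refine (MvPolynomial.totalDegree_mul _ _).trans ?_
    simp
  · have hL : ∀ j, (L j).eval (fun i => y i) = T y j := fun j => by
      have h1 : T y = T.linear y + T 0 := by
        have := T.map_vadd 0 y
        simpa using this
      have h2 := apply_eq_sum_basisVec (LinearMap.toContinuousLinearMap T.linear) y j
      simp only [LinearMap.coe_toContinuousLinearMap'] at h2
      rw [h1, PiLp.add_apply, h2]
      simp [L, add_comm]
    have h3 : (MvPolynomial.eval fun i => y i) (MvPolynomial.aeval L P) =
        MvPolynomial.eval (fun j => (L j).eval fun i => y i) P := by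
      induction P using MvPolynomial.induction_on with
      | C a => simp
      | add p q hp hq => simp only [map_add, hp, hq]
      | mul_X p j hp => simp only [map_mul, hp, MvPolynomial.aeval_X, MvPolynomial.eval_X]
    simp only [hL] at h3
    exact h3

/-- An affine map carrying an affine basis to the vertices of a simplex. -/
theorem exists_affineMap_of_affineBasis {d : ℕ} (b : AffineBasis (Fin (d + 1)) ℝ (Sp d))
    (S : Affine.Simplex ℝ (Sp d) d) : ∃ T : Sp d →ᵃ[ℝ] Sp d, (∀ i, T (b i) = S.points i) ∧
      Function.Injective T := by
  classical
  let T : Sp d →ᵃ[ℝ] Sp d :=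
    ∑ i, (LinearMap.toSpanSingleton ℝ (Sp d) (S.points i)).toAffineMap.comp (b.coord i)
  have hT : ∀ y, T y = ∑ i, b.coord i y • S.points i := fun y => by
    have : ∀ s : Finset (Fin (d + 1)),
        (∑ i ∈ s, (LinearMap.toSpanSingleton ℝ (Sp d) (S.points i)).toAffineMap.comp
          (b.coord i)) y = ∑ i ∈ s, b.coord i y • S.points i := by
      intro s
      induction s using Finset.induction_on with
      | empty => simp
      | insert i s hi ih => simp [Finset.sum_insert hi, ← ih]
    exact this _
  have hTb : ∀ i, T (b i) = S.points i := fun i => by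
    rw [hT]
    simp [AffineBasis.coord_apply]
  refine ⟨T, hTb, ?_⟩
  -- The image is an affine subspace containing the vertices of a nondegenerate simplex, so it is
  -- everything; equal dimensions then give injectivity.
  have hsurj : Function.Surjective T := by
    have h1 : (⊤ : AffineSubspace ℝ (Sp d)).map T = ⊤ := by
      conv_lhs => rw [← b.tot, AffineSubspace.map_span, ← Set.range_comp]
      rw [show (T ∘ b) = S.points from funext hTb]
      exact S.span_eq_top (by simp)
    intro x
    have hx : x ∈ (⊤ : AffineSubspace ℝ (Sp d)).map T := by
      rw [h1]; exact AffineSubspace.mem_top ℝ _ x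
    obtain ⟨y, -, hy⟩ := hx
    exact ⟨y, hy⟩
  rw [← AffineMap.linear_injective_iff, LinearMap.injective_iff_surjective,
    AffineMap.linear_surjective_iff]
  exact hsurj

theorem setIntegral_affine_image {d : ℕ} (T : Sp d →ᵃ[ℝ] Sp d) (hT : Function.Injective T)
    {K : Set (Sp d)} (hK : MeasurableSet K) (g : Sp d → ℝ) :
    ∫ x in T '' K, g x = |LinearMap.det T.linear| * ∫ y in K, g (T y) := by
  have hd : ∀ y ∈ K, HasFDerivWithinAt T (LinearMap.toContinuousLinearMap T.linear) K y :=
    fun y _ => by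
      have h1 : (T : Sp d → Sp d) = fun y => LinearMap.toContinuousLinearMap T.linear y + T 0 := by
        ext1 y
        have := T.map_vadd 0 y
        simpa using this
      rw [h1]
      exact ((ContinuousLinearMap.hasFDerivAt _).add_const _).hasFDerivWithinAt
  rw [integral_image_eq_integral_abs_det_fderiv_smul volume hK hd hT.injOn, ← integral_const_mul]
  rfl

/-- Every simplex is an affine image of one reference simplex. Volume and integral both scale by the
same determinant, so the constant depends on `d` and `r` only, without shape regularity. -/
theorem exists_polyFun_sq_mul_volume_le (d r : ℕ) : ∃ C, 0 ≤ C ∧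
    ∀ (S : Affine.Simplex ℝ (Sp d) d) (P : MvPolynomial (Fin d) ℝ), P.totalDegree ≤ r →
      ∀ x ∈ convexHull ℝ (Set.range S.points),
        polyFun P x ^ 2 * volume.real (convexHull ℝ (Set.range S.points)) ≤
          C * ∫ y in convexHull ℝ (Set.range S.points), polyFun P y ^ 2 := by
  obtain ⟨b⟩ := AffineBasis.exists_affineBasis_of_finiteDimensional (k := ℝ) (P := Sp d)
    (ι := Fin (d + 1)) (by simp)
  set K := convexHull ℝ (Set.range b) with hKdef
  have hK : IsCompact K := (Set.finite_range _).isCompact_convexHull ℝ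
  have hKi : (interior K).Nonempty :=
    interior_convexHull_nonempty_iff_affineSpan_eq_top.2 b.tot
  obtain ⟨C, hC0, hC⟩ := exists_polyFun_sq_le_integral r hK (by
    rw [(convex_convexHull ℝ _).closure_interior_eq_closure_of_nonempty_interior hKi]
    exact subset_closure)
  refine ⟨C * volume.real K, mul_nonneg hC0 measureReal_nonneg, fun S P hP x hx => ?_⟩
  obtain ⟨T, hTb, hTi⟩ := exists_affineMap_of_affineBasis b S
  have himg : convexHull ℝ (Set.range S.points) = T '' K := by
    rw [hKdef, AffineMap.image_convexHull, ← Set.range_comp]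
    rw [show (T ∘ b) = S.points from funext hTb]
  obtain ⟨R, hR, hRT⟩ := exists_polyFun_comp_affine T P
  have hvol : volume.real (T '' K) = |LinearMap.det T.linear| * volume.real K := by
    have := setIntegral_affine_image T hTi hK.measurableSet fun _ => 1
    simpa using this
  rw [himg] at hx ⊢
  obtain ⟨y, hy, rfl⟩ := hx
  rw [hvol, setIntegral_affine_image T hTi hK.measurableSet fun x => polyFun P x ^ 2]
  have h1 := hC R (hR.trans hP) y hy
  simp only [hRT] at h1
  have h2 := mul_le_mul_of_nonneg_right h1
    (mul_nonneg (abs_nonneg (LinearMap.det T.linear)) (measureReal_nonneg (μ := volume) (s := K)))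
  linarith

/-- A barycentric coordinate is the signed distance to the opposite face divided by the height. The
incenter has signed distance equal to the inradius, so within the ball no coordinate can become
negative. -/
theorem ball_incenter_subset {d : ℕ} [NeZero d] (S : Affine.Simplex ℝ (Sp d) d) :
    Metric.ball S.incenter S.inradius ⊆ convexHull ℝ (Set.range S.points) := by
  intro x hx
  have hmem : x ∈ affineSpan ℝ (Set.range S.points) := by
    rw [S.span_eq_top (by simp)]; exact AffineSubspace.mem_top ℝ _ x
  obtain ⟨w, hw, rfl⟩ := eq_affineCombination_of_mem_affineSpan_of_fintype hmem
  refine affineCombination_mem_convexHull (fun i _ => ?_) hw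
  have h1 := S.signedInfDist_affineCombination i hw
  have h2 := S.signedInfDist_incenter i
  set x := Finset.univ.affineCombination ℝ S.points w
  have h3 : S.signedInfDist i S.incenter - S.signedInfDist i x ≤ dist S.incenter x := by
    rw [Affine.Simplex.signedInfDist, AffineSubspace.signedInfDist_def, signedDist_triangle_left,
      dist_comm]
    exact (le_abs_self _).trans (abs_signedDist_le_dist _ _ _)
  rw [Metric.mem_ball, dist_comm] at hx
  rw [h2, h1] at h3
  by_contra! hneg
  nlinarith [norm_nonneg (S.points i -ᵥ (S.faceOpposite i).orthogonalProjectionSpan (S.points i))]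

theorem volume_ball_mul_inradius_pow_le {d : ℕ} [NeZero d] (S : Affine.Simplex ℝ (Sp d) d) :
    volume.real (Metric.ball (0 : Sp d) 1) * S.inradius ^ d ≤
      volume.real (convexHull ℝ (Set.range S.points)) := by
  have h1 := congrArg ENNReal.toReal
    (Measure.addHaar_ball_of_pos (volume : Measure (Sp d)) S.incenter S.inradius_pos)
  rw [finrank_euclideanSpace_fin, ENNReal.toReal_mul,
    ENNReal.toReal_ofReal (pow_nonneg S.inradius_pos.le d), ← measureReal_def,
    ← measureReal_def] at h1
  rw [mul_comm, ← h1]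
  exact measureReal_mono (ball_incenter_subset S)
    ((Set.finite_range _).isCompact_convexHull ℝ).measure_ne_top

/-- The face integral of v² is at most the face measure times sup v², that is, of order h_e^(d-1)
‖v‖² / |Ω_e|. The inscribed ball bounds |Ω_e| below by a multiple of (h_e / σ)^d, leaving one factor
1 / h_e. -/
theorem Mesh.exists_isTraceConstant (d : ℕ) [NeZero d] (r : ℕ) (σ : ℝ) :
    ∃ Ctr : ℝ, 0 < Ctr ∧ ∀ M : Mesh d, M.ShapeRegular σ → M.IsTraceConstant r Ctr := by
  classical
  obtain ⟨C, hC0, hC⟩ := exists_polyFun_sq_mul_volume_le d r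
  set v := volume.real (Metric.ball (0 : Sp d) 1) with hv
  have hv0 : 0 < v := ENNReal.toReal_pos (Metric.measure_ball_pos _ _ one_pos).ne'
    measure_ball_lt_top.ne
  set c := simplexConst (d - 1) with hc
  have hc0 : 0 ≤ c := mul_nonneg ENNReal.toReal_nonneg (by positivity)
  set B := c * C * |σ| ^ d / v with hB
  have hB0 : 0 ≤ B := by positivity
  -- The factor `d + 1` counts the faces that may lie on Γ; the summand 1 makes the constant
  -- positive even if `B` is zero.
  refine ⟨√((d + 1) * B + 1), Real.sqrt_pos.2 (by positivity), fun M hM e P hP => ?_⟩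
  set I := ∫ x in M.cell e, polyFun P x ^ 2 with hI
  have hI0 : 0 ≤ I := integral_nonneg fun _ => sq_nonneg _
  set h := M.elemSize e with hh
  have hh0 : 0 < h := M.elemSize_pos e
  have hcell : |σ| ^ d * volume.real (M.cell e) ≥ v * h ^ d := by
    have h1 : h ≤ |σ| * (M.elem e).inradius := (hM e).trans
      (mul_le_mul_of_nonneg_right (le_abs_self σ) (M.elem e).inradius_pos.le)
    have h2 := pow_le_pow_left₀ hh0.le h1 d
    rw [mul_pow] at h2
    have h3 := volume_ball_mul_inradius_pow_le (M.elem e)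
    calc v * h ^ d ≤ v * (|σ| ^ d * (M.elem e).inradius ^ d) := by gcongr
      _ = |σ| ^ d * (v * (M.elem e).inradius ^ d) := by ring
      _ ≤ |σ| ^ d * volume.real (M.cell e) := by gcongr; exact h3
  have hvol : 0 < volume.real (M.cell e) :=
    lt_of_lt_of_le (mul_pos hv0 (pow_pos (M.elem e).inradius_pos d))
      (volume_ball_mul_inradius_pow_le (M.elem e))
  have hface : ∀ i, h * ∫ x in M.face e i, polyFun P x ^ 2 ∂μHE[d - 1] ≤ B * I := by
    intro i
    have h1 : ∫ x in M.face e i, polyFun P x ^ 2 ∂μHE[d - 1] ≤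
        C * I / volume.real (M.cell e) * (c * h ^ (d - 1)) := by
      have hbound : ∀ x ∈ M.face e i, ‖polyFun P x ^ 2‖ ≤ C * I / volume.real (M.cell e) := by
        intro x hx
        rw [Real.norm_of_nonneg (sq_nonneg _), le_div_iff₀ hvol]
        exact hC (M.elem e) P hP x (M.face_subset_cell e i hx)
      refine (le_abs_self _).trans ((norm_setIntegral_le_of_norm_le_const
        (M.measure_face_lt_top e i) hbound).trans ?_)
      refine mul_le_mul_of_nonneg_left ?_ (by positivity)
      exact ENNReal.toReal_le_of_le_ofReal (by positivity) (M.measure_face_le e i)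
    have hpow : h * h ^ (d - 1) = h ^ d := mul_pow_sub_one (NeZero.ne d) h
    calc h * ∫ x in M.face e i, polyFun P x ^ 2 ∂μHE[d - 1]
        ≤ h * (C * I / volume.real (M.cell e) * (c * h ^ (d - 1))) := by gcongr
      _ = C * I * c * (h * h ^ (d - 1)) / volume.real (M.cell e) := by ring
      _ ≤ B * I := by
        rw [hpow, div_le_iff₀ hvol, hB]
        have : C * I * c * h ^ d * v ≤ C * I * c * (|σ| ^ d * volume.real (M.cell e)) := by
          rw [mul_assoc _ _ v, mul_comm _ v]
          exact mul_le_mul_of_nonneg_left hcell (by positivity)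
        rw [div_mul_eq_mul_div, div_mul_eq_mul_div, le_div_iff₀ hv0]
        linarith
  have hbdry : h * (M.bdryIntegral e fun _ x => polyFun P x ^ 2) ≤ (d + 1) * B * I := by
    rw [Mesh.bdryIntegral, Finset.mul_sum]
    refine (Finset.sum_le_card_nsmul _ _ (B * I) fun i _ => ?_).trans (le_of_eq ?_)
    · split_ifs
      · exact hface i
      · rw [mul_zero]; positivity
    · simp; ring
  have key : ∀ X : ℝ, h * X ≤ (d + 1) * B * I → √h * √X ≤ √((d + 1) * B + 1) * √I := by
    intro X hX
    rw [← Real.sqrt_mul hh0.le, ← Real.sqrt_mul (by positivity)]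
    refine Real.sqrt_le_sqrt (hX.trans ?_)
    linarith
  refine ⟨fun i => key _ ((hface i).trans ?_), key _ hbdry⟩
  have : 0 ≤ (d : ℝ) * (B * I) := by positivity
  linarith

end SplittingSAV

theorem mainTheorem1 (d : ℕ) [NeZero d] (hd : d = 2 ∨ d = 3)
    (k l : ℕ) (hk : 1 ≤ k) (hl : 1 ≤ l) :
    -- trace constants exist and depend only on shape regularity, dimension and degree
    (∀ σ : ℝ, ∃ Ctr : ℝ, 0 < Ctr ∧
      ∀ M : Mesh d, M.ShapeRegular σ → M.IsTraceConstant (max k l) Ctr) ∧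
    -- stability of the scheme, with `C = (C_tr² Q)²`
    ∀ (M : Mesh d) (Q Ctr : ℝ), M.QuasiUniform Q → M.IsTraceConstant (max k l) Ctr →
      ∀ (ν γ α T : ℝ), 0 < ν → 0 < γ → 0 < α → 0 < T → ∀ N : ℕ, 1 ≤ N →
      ∀ τ : ℝ, τ = T / N →
      ∀ (u : ℕ → Sp d → Sp d) (p : ℕ → Sp d → ℝ) (ψ : ℕ → ℝ),
        IsSolution M k l ν γ α τ N u p ψ →
        (energy M α u ψ N +
            ∑ n ∈ Finset.Icc 2 N,
              ((secondDiff ψ n / √α) ^ 2 + l2Norm M.domain (secondDiff u n) ^ 2 +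
                4 * τ * ν * l2Norm M.domain (gradTensor (u n)) ^ 2 +
                4 * γ * τ * ν * l2Norm M.domain (div (u n)) ^ 2) =
          energy M α u ψ 1) ∧
        (energy M α u ψ N +
            ∑ n ∈ Finset.Icc 2 N,
              (8 / 7 * τ * beta M ν ((Ctr ^ 2 * Q) ^ 2) u n * ψ n ^ 2 *
                  l2Norm M.domain (gradient (p n)) ^ 2 +
                (secondDiff ψ n / √α) ^ 2 + l2Norm M.domain (secondDiff u n) ^ 2 +
                4 * τ * ν * γ * l2Norm M.domain (div (u n)) ^ 2) ≤
          energy M α u ψ 1) := by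
  refine ⟨Mesh.exists_isTraceConstant d (max k l), ?_⟩
  intro M Q Ctr hQ hC ν γ α T hν hγ hα hT N hN τ hτ u p ψ h
  have hτ0 : 0 < τ := hτ ▸ div_pos hT (Nat.cast_pos.2 hN)
  have hE := h.energy_identity hα hτ0 hN
  refine ⟨hE, ?_⟩
  -- With the initial energy expanded by the identity, the sums compare term by term: only the
  -- viscous term is exchanged for the pressure term.
  rw [← hE]
  refine add_le_add_right (Finset.sum_le_sum fun n hn => ?_) _
  obtain ⟨hn2, hnN⟩ := Finset.mem_Icc.1 hn
  have h1 := mul_le_mul_of_nonneg_left (h.pressure_bound hd hC hQ hν hn2 hnN) hτ0.le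
  linarith
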